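/- Theorem (Borel determinacy, Martin). Let $A$ be an arbitrary set. A tree on $A$ is a set $T$ of finite sequences in $A$ that is closed under taking prefixes; it is pruned if every $x\in T$ has a proper extension in $T$. Its body $[T]\subseteq A^{\mathbb N}$ is the set of infinite sequences all of whose finite prefixes lie in $T$, with the subspace topology of the product topology on $A^{\mathbb N}$, where $A$ is discrete. A Gale–Stewart game is a pair $(T,P)$ of a nonempty pruned tree $T$ on $A$ and a payoff set $P\subseteq[T]$. Players $0$ and $1$ alternately choose elements of $A$, starting with player $0$, so that all finite sequences that arise lie in $T$; player $0$ wins the resulting infinite play $b\in[T]$ if $b\in P$, and player $1$ wins if $b\notin P$. A strategy of player $i\in\{0,1\}$ assigns to every $x\in T$ with $|x|\equiv i\pmod 2$ an element $a\in A$ such that the extension of $x$ by $a$ lies in $T$; it is winning if player $i$ wins every play in which all moves of player $i$ are those given by the strategy. If $P$ belongs to the $\sigma$-algebra on $[T]$ generated by the open subsets of $[T]$, then the game $(T,P)$ is determined, that is, at least one of the two players has a winning strategy. -/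

import Mathlib

namespace GaleStewart

/-- The finite prefix `(b 0, ..., b (n - 1))` of length `n` of an infinite sequence `b`. -/
def initSeg {A : Type*} (b : ℕ → A) (n : ℕ) : List A :=
  List.ofFn fun k : Fin n => b k

/-- A tree is pruned if it has no leaves: each of its nodes has a child in the tree.
(By closure under prefixes, a node with a proper extension in the tree has a child in it.) -/
def IsPruned {A : Type*} (T : Descriptive.tree A) : Prop :=
  ∀ x ∈ T, ∃ a : A, x ++ [a] ∈ T

/-- The body `[T]` of a tree: the infinite sequences all of whose finite prefixes lie in `T`. -/
def body {A : Type*} (T : Descriptive.tree A) : Set (ℕ → A) :=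
  {b | ∀ n : ℕ, initSeg b n ∈ T}

/-- The topology of the body: the subspace topology of the product topology on `ℕ → A`,
where every factor `A` carries the discrete topology `⊥`. -/
abbrev bodyTopology {A : Type*} (T : Descriptive.tree A) : TopologicalSpace (body T) :=
  TopologicalSpace.induced Subtype.val
    (@Pi.topologicalSpace ℕ (fun _ => A) (fun _ => (⊥ : TopologicalSpace A)))

/-- A Gale-Stewart game on `A`: a nonempty pruned tree with a payoff set in its body. -/
structure Game (A : Type*) where
  tree : Descriptive.tree A
  nonempty : ∃ x : List A, x ∈ tree
  pruned : IsPruned tree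
  payoff : Set (body tree)

namespace Game

/-- A game is Borel if its payoff set lies in the σ-algebra on the body of the tree
generated by the open sets. -/
def IsBorel {A : Type*} (G : Game A) : Prop :=
  @MeasurableSet (body G.tree) (@borel (body G.tree) (bodyTopology G.tree)) G.payoff

/-- A strategy of player `i`: a function that chooses, at every position `x` of player `i`
(a node of the tree whose length is congruent to `i` modulo `2`), a legal move `a`,
and hence the successor position `x ++ [a]`. -/
def Strategy {A : Type*} (G : Game A) (i : Fin 2) : Type _ :=
  ∀ x : List A, x ∈ G.tree → x.length % 2 = (i : ℕ) → {a : A // x ++ [a] ∈ G.tree}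

/-- A play `b` is consistent with a strategy `σ` of player `i` if each of the moves of player `i`
in `b` (the moves with index congruent to `i` modulo `2`) is the one given by `σ`. -/
def Strategy.Consistent {A : Type*} {G : Game A} {i : Fin 2} (σ : G.Strategy i)
    (b : body G.tree) : Prop :=
  ∀ (n : ℕ) (hn : n % 2 = (i : ℕ)),
    b.1 n = (σ (initSeg b.1 n) (b.2 n) (by simpa [initSeg] using hn)).1

/-- Player `0` wins the plays in the payoff set, player `1` wins all the others. -/
def WonBy {A : Type*} (G : Game A) (i : Fin 2) (b : body G.tree) : Prop :=
  if i = 0 then b ∈ G.payoff else b ∉ G.payoff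

/-- A strategy of player `i` is winning if player `i` wins all plays consistent with it. -/
def Strategy.IsWinning {A : Type*} {G : Game A} {i : Fin 2} (σ : G.Strategy i) : Prop :=
  ∀ b : body G.tree, σ.Consistent b → G.WonBy i b

/-- A game is determined if at least one of the two players has a winning strategy. -/
def IsDetermined {A : Type*} (G : Game A) : Prop :=
  ∃ (i : Fin 2) (σ : G.Strategy i), σ.IsWinning

end Game

end GaleStewart

/-!
The proof is Martin's inductive proof by unraveling. A covering of a tree `X` is a tree `Y` with a
projection to `X`, such that a strategy `σ` on `Y` induces a strategy of the same player on `X` all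
of whose plays are projections of plays consistent with `σ` (`Cover`). If the payoff set becomes
open in a covering, then the game there is determined (`exists_winning_of_isOpenSet`), and hence so
is the original game (`Unravelable.exists_winning`). It remains to see that every Borel set becomes
clopen in some covering, even in one that changes nothing up to a prescribed length `k`. The sets
with this property are closed under complements, so two things have to be shown.

* Open sets have the property (`exists_cover_of_isOpenSet`). Let `D` be the set of positions from
  which every play lies in the open set. In the covering tree, player `0` announces at some length
  `N` a quasi-strategy `s` to which they commit, and player `1` replies either with a position
  `u ∈ s ∩ D`, through which the play then has to pass, or with a quasi-strategy of their own inside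
  `s` that avoids `D`. The reply decides whether the play lies in the open set. To transfer a
  strategy `σ` of one player to `X`, where nothing is announced, this player tries to force the play
  into the positions `u` that make it compatible with the first kind of reply. As long as this
  cannot be forced, they follow `σ`, imagining that the opponent announced the quasi-strategy of
  preventing it; once it can be forced, they do so, and after reaching `u` they follow `σ` again,
  imagining the announcements that belong to `u` (`follow`, `follow_cases`).

* The property passes to countable unions (`Unravelable.iUnion`). The sets are unraveled one after
  the other, the `i`-th by a covering that changes nothing up to length `k + i`. The inverse limit
  of such a sequence is a covering (`limitCover`), since at each position only finitely many steps
  matter. There the union is open, and is unraveled by one more covering.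

Positions are points of an abstract type with a length and a predecessor (`PosTree`), and not lists,
so that the positions of inverse limits can be coherent sequences of positions, and those of the
unraveling tree can be positions of `X` together with the announcements.
-/

open Set
open scoped Topology

universe u

namespace GaleStewart

/-! ### Trees of positions and their branches -/

/-- A tree of height `ω` without leaves, given by its positions. Every position has a length and
an immediate predecessor `par x` (a junk value if `x` has length `0`). Several positions of
length `0` are allowed. -/
structure PosTree where
  Pos : Type u
  len : Pos → ℕ
  par : Pos → Pos
  len_par : ∀ x, len (par x) = len x - 1
  exists_child : ∀ x, ∃ y, par y = x ∧ len y = len x + 1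

namespace PosTree

variable (X : PosTree.{u})

/-- `y` is an immediate successor of `x`. -/
def IsChild (y x : X.Pos) : Prop := X.par y = x ∧ X.len y = X.len x + 1

lemma exists_isChild (x : X.Pos) : ∃ y, X.IsChild y x := X.exists_child x

/-- The ancestor of `x` of length `m`, or `x` itself if `x` is shorter than `m`. -/
def trunc (m : ℕ) (x : X.Pos) : X.Pos := X.par^[X.len x - m] x

lemma len_iterate_par (j : ℕ) (x : X.Pos) : X.len (X.par^[j] x) = X.len x - j := by
  induction j with
  | zero => rfl
  | succ j ih => rw [Function.iterate_succ_apply', X.len_par, ih]; omega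

lemma len_trunc (m : ℕ) (x : X.Pos) : X.len (X.trunc m x) = min m (X.len x) := by
  rw [trunc, len_iterate_par]; omega

variable {X}

lemma trunc_of_len_le {m : ℕ} {x : X.Pos} (h : X.len x ≤ m) : X.trunc m x = x := by
  rw [trunc, Nat.sub_eq_zero_of_le h]; rfl

lemma trunc_par {m : ℕ} {x : X.Pos} (h : m < X.len x) : X.trunc m (X.par x) = X.trunc m x := by
  rw [trunc, trunc, X.len_par, ← Function.iterate_succ_apply]
  congr 1; omega

lemma IsChild.trunc {m : ℕ} {x y : X.Pos} (h : X.IsChild y x) (hm : m ≤ X.len x) :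
    X.trunc m y = X.trunc m x := by
  rw [← h.1, trunc_par]; have := h.2; omega

lemma trunc_trunc {m n : ℕ} (h : m ≤ n) (x : X.Pos) :
    X.trunc m (X.trunc n x) = X.trunc m x := by
  rw [trunc, len_trunc, trunc, ← Function.iterate_add_apply, trunc]
  congr 1; omega

variable (X)

/-- The infinite plays through the tree, as sequences of positions. -/
structure Branch where
  toFun : ℕ → X.Pos
  len_apply : ∀ n, X.len (toFun n) = n
  par_apply : ∀ n, X.par (toFun (n + 1)) = toFun n

instance : CoeFun X.Branch (fun _ => ℕ → X.Pos) := ⟨Branch.toFun⟩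

/-- A choice of a successor at every position. The positions of both players are included; which
of the choices matter depends on the player, see `Strat.Consistent`. -/
structure Strat where
  toFun : X.Pos → X.Pos
  isChild : ∀ x, X.IsChild (toFun x) x

instance : CoeFun X.Strat (fun _ => X.Pos → X.Pos) := ⟨Strat.toFun⟩

variable {X}

namespace Branch

@[ext] lemma ext {b b' : X.Branch} (h : ∀ n, b n = b' n) : b = b' := by
  cases b; cases b'; congr; exact funext h

lemma isChild (b : X.Branch) (n : ℕ) : X.IsChild (b (n + 1)) (b n) :=
  ⟨b.par_apply n, by rw [b.len_apply, b.len_apply]⟩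

lemma trunc_apply (b : X.Branch) (m n : ℕ) : X.trunc m (b n) = b (min m n) := by
  induction n with
  | zero => rw [trunc_of_len_le (by simp [b.len_apply])]; simp
  | succ n ih =>
    rcases le_or_gt m n with h | h
    · rw [(b.isChild n).trunc (by rwa [b.len_apply]), ih]; congr 1; omega
    · rw [trunc_of_len_le (by rw [b.len_apply]; omega)]; congr 1; omega

lemma eq_of_le {b b' : X.Branch} {m n : ℕ} (h : m ≤ n) (he : b n = b' n) : b m = b' m := by
  have h1 := b.trunc_apply m n
  rw [he, b'.trunc_apply, min_eq_left h] at h1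
  exact h1.symm

end Branch

namespace Strat

noncomputable instance : Inhabited X.Strat :=
  ⟨fun x => (X.exists_child x).choose, fun x => (X.exists_child x).choose_spec⟩

/-- The moves of player `p` in the play `b` are those given by `σ`. -/
def Consistent (p : Fin 2) (σ : X.Strat) (b : X.Branch) : Prop :=
  ∀ n, n % 2 = (p : ℕ) → b (n + 1) = σ (b n)

/-- The strategies `σ` and `τ` of player `p` agree at all positions of length less than `n`. -/
def AgreeBelow (p : Fin 2) (n : ℕ) (σ τ : X.Strat) : Prop :=
  ∀ x, X.len x < n → X.len x % 2 = (p : ℕ) → σ x = τ x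

lemma AgreeBelow.refl (p : Fin 2) (n : ℕ) (σ : X.Strat) : AgreeBelow p n σ σ := fun _ _ _ => rfl

end Strat

/-! ### Forcing a set of positions -/

/-- The positions from which player `p` can force the play to pass through `U`. -/
def Win (X : PosTree.{u}) (p : Fin 2) (U : Set X.Pos) : Set X.Pos :=
  {x | ∃ σ : X.Strat, ∀ b : X.Branch, b (X.len x) = x →
    (∀ n, X.len x ≤ n → n % 2 = (p : ℕ) → b (n + 1) = σ (b n)) → ∃ m, b m ∈ U}

lemma subset_win (p : Fin 2) (U : Set X.Pos) : U ⊆ X.Win p U :=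
  fun x hx => ⟨default, fun _ hb _ => ⟨X.len x, by rwa [hb]⟩⟩

lemma not_mem_win_of_isChild {p : Fin 2} {U : Set X.Pos} {x y : X.Pos} (hx : x ∉ X.Win p U)
    (hp : X.len x % 2 = (p : ℕ)) (hy : X.IsChild y x) : y ∉ X.Win p U := by
  classical
  rintro ⟨σ, hσ⟩
  refine hx ⟨⟨fun z => if z = x then y else σ z, fun z => ?_⟩, fun b hb hc => ?_⟩
  · split_ifs with h
    · rwa [h]
    · exact σ.isChild z
  · have h1 := hc _ le_rfl hp
    simp only [hb, if_true] at h1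
    refine hσ b (by rw [hy.2, h1]) fun n hn hnp => ?_
    rw [hy.2] at hn
    rw [hc n (by omega) hnp]
    refine if_neg fun h => ?_
    have := congrArg X.len h
    rw [b.len_apply] at this
    omega

lemma exists_isChild_not_mem_win {p : Fin 2} {U : Set X.Pos} {x : X.Pos} (hx : x ∉ X.Win p U) :
    ∃ y, X.IsChild y x ∧ y ∉ X.Win p U := by
  by_contra! h
  -- Glue winning strategies for all the successors of `x` into one for `x`.
  have h' : ∀ y, ∃ σ : X.Strat, X.IsChild y x → ∀ b : X.Branch, b (X.len y) = y →
      (∀ n, X.len y ≤ n → n % 2 = (p : ℕ) → b (n + 1) = σ (b n)) → ∃ m, b m ∈ U := fun y => by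
    by_cases hy : X.IsChild y x
    · obtain ⟨σ, hσ⟩ := h y hy
      exact ⟨σ, fun _ => hσ⟩
    · exact ⟨default, fun h => absurd h hy⟩
  choose s hs using h'
  refine hx ⟨⟨fun z => s (X.trunc (X.len x + 1) z) z, fun z => (s _).isChild z⟩,
    fun b hb hc => ?_⟩
  have hch : X.IsChild (b (X.len x + 1)) x := by
    have := b.isChild (X.len x)
    rwa [hb] at this
  refine hs _ hch b (by rw [b.len_apply]) fun n hn hnp => ?_
  rw [b.len_apply] at hn
  rw [hc n (by omega) hnp]
  dsimp only
  rw [b.trunc_apply, min_eq_left hn]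

open Classical in
/-- A strategy of player `p` forcing the play from `w` to pass through `U`, if there is one. -/
noncomputable def winStrat (p : Fin 2) (U : Set X.Pos) (w : X.Pos) : X.Strat :=
  if h : w ∈ X.Win p U then h.choose else default

lemma winStrat_spec {p : Fin 2} {U : Set X.Pos} {w : X.Pos} (hw : w ∈ X.Win p U) (b : X.Branch)
    (hb : b (X.len w) = w)
    (hc : ∀ n, X.len w ≤ n → n % 2 = (p : ℕ) → b (n + 1) = winStrat p U w (b n)) :
    ∃ m, b m ∈ U := by
  refine hw.choose_spec b hb ?_
  rw [winStrat, dif_pos hw] at hc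
  exact hc

/-! ### Open sets of branches -/

/-- A set of branches is open if it contains, with a branch, all branches that share a
sufficiently long initial segment with it. -/
def IsOpenSet (O : Set X.Branch) : Prop :=
  ∀ b ∈ O, ∃ n, ∀ b' : X.Branch, b' n = b n → b' ∈ O

/-- The positions all of whose branches lie in `O`. -/
def sure (O : Set X.Branch) : Set X.Pos := {x | ∀ b : X.Branch, b (X.len x) = x → b ∈ O}

lemma mem_of_mem_sure {O : Set X.Branch} {b : X.Branch} {n : ℕ} (h : b n ∈ sure O) : b ∈ O :=
  h b (by rw [b.len_apply])

lemma IsOpenSet.exists_mem_sure {O : Set X.Branch} (hO : IsOpenSet O) {b : X.Branch}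
    (hb : b ∈ O) : ∃ n, ∀ m, n ≤ m → b m ∈ sure O := by
  obtain ⟨n, hn⟩ := hO b hb
  refine ⟨n, fun m hm b' hb' => hn b' ?_⟩
  rw [b.len_apply] at hb'
  exact Branch.eq_of_le hm hb'

/-- Determinacy of open games on a tree with a single root. -/
lemma exists_winning_of_isOpenSet {O : Set X.Branch} (hO : IsOpenSet O) {r : X.Pos}
    (hr0 : X.len r = 0) (hr : ∀ x, X.len x = 0 → x = r) :
    ∃ (p : Fin 2) (σ : X.Strat), ∀ b, σ.Consistent p b → (if p = 0 then b ∈ O else b ∉ O) := by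
  classical
  by_cases hw : r ∈ X.Win 0 (sure O)
  · obtain ⟨σ, hσ⟩ := hw
    refine ⟨0, σ, fun b hb => ?_⟩
    obtain ⟨m, hm⟩ := hσ b (hr _ (by rw [b.len_apply, hr0])) fun n _ hn => hb n hn
    exact if_pos rfl ▸ mem_of_mem_sure hm
  · have key : ∀ x, ∃ y, X.IsChild y x ∧
        (X.len x % 2 = 1 → x ∉ X.Win 0 (sure O) → y ∉ X.Win 0 (sure O)) := fun x => by
      by_cases h : X.len x % 2 = 1 ∧ x ∉ X.Win 0 (sure O)
      · obtain ⟨y, hy, hy'⟩ := exists_isChild_not_mem_win h.2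
        exact ⟨y, hy, fun _ _ => hy'⟩
      · obtain ⟨y, hy⟩ := X.exists_isChild x
        exact ⟨y, hy, fun h1 h2 => absurd ⟨h1, h2⟩ h⟩
    choose f hf hf' using key
    refine ⟨1, ⟨f, hf⟩, fun b hb => ?_⟩
    have hn : ∀ n, b n ∉ X.Win 0 (sure O) := fun n => by
      induction n with
      | zero => rwa [hr _ (b.len_apply 0)]
      | succ n ih =>
        rcases Nat.mod_two_eq_zero_or_one n with h | h
        · exact not_mem_win_of_isChild ih (by rw [b.len_apply, h]; rfl) (b.isChild n)
        · rw [hb n h]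
          exact hf' _ (by rw [b.len_apply, h]) ih
    rw [if_neg (by decide)]
    intro hbO
    obtain ⟨n, h⟩ := hO.exists_mem_sure hbO
    exact hn n (subset_win _ _ (h n le_rfl))

variable {X Y Z : PosTree.{u}}

/-! ### Coverings -/

/-- A map of trees, preserving length and predecessors. -/
structure Hom (Y X : PosTree.{u}) where
  toFun : Y.Pos → X.Pos
  len_apply : ∀ y, X.len (toFun y) = Y.len y
  map_par : ∀ y, toFun (Y.par y) = X.par (toFun y)

instance : CoeFun (Hom Y X) (fun _ => Y.Pos → X.Pos) := ⟨Hom.toFun⟩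

/-- The identity map. -/
def Hom.id (X : PosTree.{u}) : Hom X X := ⟨fun x => x, fun _ => rfl, fun _ => rfl⟩

/-- The composite of two maps. -/
def Hom.comp (f : Hom Y X) (g : Hom Z Y) : Hom Z X :=
  ⟨fun z => f (g z), fun z => by rw [f.len_apply, g.len_apply],
    fun z => by rw [g.map_par, f.map_par]⟩

lemma Hom.isChild (f : Hom Y X) {y z : Y.Pos} (h : Y.IsChild y z) : X.IsChild (f y) (f z) :=
  ⟨by rw [← f.map_par, h.1], by rw [f.len_apply, f.len_apply, h.2]⟩

/-- The image of a branch under a map of trees. -/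
def Branch.map (f : Hom Y X) (b : Y.Branch) : X.Branch :=
  ⟨fun n => f (b n), fun n => by rw [f.len_apply, b.len_apply],
    fun n => by rw [← f.map_par, b.par_apply]⟩

lemma IsOpenSet.preimage {O : Set X.Branch} (hO : IsOpenSet O) (f : Hom Y X) :
    IsOpenSet (Branch.map f ⁻¹' O) := fun b hb => by
  obtain ⟨n, hn⟩ := hO _ hb
  exact ⟨n, fun b' h => hn _ (congrArg f h)⟩

/-- A `k`-covering of `X` by `Y`: a map `Y → X` together with a way to turn strategies on `Y`
into strategies on `X`, such that every play consistent with the resulting strategy is the image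
of a play consistent with the given one. The dependence of the resulting strategy on the given
one is local, and up to length `k` nothing is changed. -/
structure Cover (k : ℕ) (Y X : PosTree.{u}) extends Hom Y X where
  strat : Fin 2 → Y.Strat → X.Strat
  strat_local : ∀ p n σ σ', Strat.AgreeBelow p n σ σ' →
    Strat.AgreeBelow p n (strat p σ) (strat p σ')
  inj : ∀ y z, Y.len y ≤ k → toFun y = toFun z → y = z
  surj : ∀ x, X.len x ≤ k → ∃ y, toFun y = x
  strat_apply : ∀ (p : Fin 2) (σ : Y.Strat) y, Y.len y < k → Y.len y % 2 = (p : ℕ) →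
    strat p σ (toFun y) = toFun (σ y)
  lift : ∀ p σ (b : X.Branch), (strat p σ).Consistent p b →
    ∃ c : Y.Branch, σ.Consistent p c ∧ c.map toHom = b

/-- A covering stays a covering if fewer levels are required to be unchanged. -/
def Cover.mono {k l : ℕ} (h : k ≤ l) (c : Cover l Y X) : Cover k Y X where
  toHom := c.toHom
  strat := c.strat
  strat_local := c.strat_local
  inj y z hy := c.inj y z (hy.trans h)
  surj x hx := c.surj x (hx.trans h)
  strat_apply p σ y hy := c.strat_apply p σ y (hy.trans_le h)
  lift := c.lift

/-- The composite of two coverings. -/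
def Cover.comp {k : ℕ} (c : Cover k Y X) (d : Cover k Z Y) : Cover k Z X where
  toHom := c.toHom.comp d.toHom
  strat p σ := c.strat p (d.strat p σ)
  strat_local p n σ σ' h := c.strat_local p n _ _ (d.strat_local p n _ _ h)
  inj y z hy h := d.inj y z hy (c.inj _ _ (by rwa [d.len_apply]) h)
  surj x hx := by
    obtain ⟨y, rfl⟩ := c.surj x hx
    obtain ⟨z, rfl⟩ := d.surj y (by rwa [c.len_apply] at hx)
    exact ⟨z, rfl⟩
  strat_apply p σ z hz hp := by
    change c.strat p (d.strat p σ) (c.toFun (d.toFun z)) = c.toFun (d.toFun (σ z))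
    rw [c.strat_apply p _ _ (by rwa [d.len_apply]) (by rwa [d.len_apply]),
      d.strat_apply p σ z hz hp]
  lift p σ b hb := by
    obtain ⟨b', hb', rfl⟩ := c.lift p _ b hb
    obtain ⟨b'', hb'', rfl⟩ := d.lift p _ b' hb'
    exact ⟨b'', hb'', rfl⟩

/-! ### Inverse limits of coverings -/

section Limit

variable {k : ℕ} (W : ℕ → PosTree.{u}) (c : ∀ i, Cover (k + i) (W (i + 1)) (W i))

/-- A coherent choice of a position in each tree of an inverse system. -/
@[ext]
structure Thread : Type u where
  app : ∀ i, (W i).Pos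
  map_app : ∀ i, (c i).toFun (app (i + 1)) = app i

variable {W c}

namespace Thread

lemma len_eq (t : Thread W c) (i : ℕ) : (W i).len (t.app i) = (W 0).len (t.app 0) := by
  induction i with
  | zero => rfl
  | succ i ih => rw [← ih, ← t.map_app i, (c i).len_apply]

/-- From the index `j` on, the components of a thread determine each other. -/
lemma eq_of_apply_eq {s t : Thread W c} (j : ℕ) (hj : (W 0).len (s.app 0) ≤ k + j)
    (h : s.app j = t.app j) : s = t := by
  have up : ∀ m, s.app (j + m) = t.app (j + m) := fun m => by
    induction m with
    | zero => exact h
    | succ m ih =>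
      refine (c (j + m)).inj _ _ ?_ ?_
      · have := s.len_eq (j + m + 1)
        have : (W (j + m + 1)).len (s.app (j + (m + 1))) = _ := this
        omega
      · exact (s.map_app (j + m)).trans (ih.trans (t.map_app (j + m)).symm)
  have down : ∀ m i, s.app (i + m) = t.app (i + m) → s.app i = t.app i := fun m => by
    induction m with
    | zero => exact fun _ h => h
    | succ m ih =>
      intro i h
      refine ih i ?_
      rw [← s.map_app (i + m), ← t.map_app (i + m)]
      exact congrArg _ h
  refine Thread.ext (funext fun i => down j i ?_)
  rw [add_comm i j]
  exact up i

/-- Every coherent family of positions that is given from the index `j` on extends to a thread. -/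
lemma exists_extending (j : ℕ) (a : ∀ i, j ≤ i → (W i).Pos)
    (ha : ∀ i h, (c i).toFun (a (i + 1) (h.trans i.le_succ)) = a i h) :
    ∃ t : Thread W c, ∀ i h, t.app i = a i h := by
  induction j with
  | zero => exact ⟨⟨fun i => a i i.zero_le, fun i => ha i _⟩, fun _ _ => rfl⟩
  | succ j ih =>
    classical
    obtain ⟨t, ht⟩ := ih
      (fun i hi => if h : j + 1 ≤ i then a i h else
        (c i).toFun (a (i + 1) (Nat.succ_le_succ hi))) fun i hi => by
        rw [dif_pos (Nat.succ_le_succ hi)]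
        split_ifs with h
        · exact ha i h
        · rfl
    exact ⟨t, fun i hi => by rw [ht i (by omega), dif_pos hi]⟩

lemma exists_apply_eq (j : ℕ) (y : (W j).Pos) (hy : (W j).len y ≤ k + j) :
    ∃ t : Thread W c, t.app j = y := by
  have step : ∀ i (z : {z : (W i).Pos // (W i).len z ≤ k + i}),
      ∃ z' : {z : (W (i + 1)).Pos // (W (i + 1)).len z ≤ k + (i + 1)},
        (c i).toFun z'.1 = z.1 := fun i z => by
    obtain ⟨z', hz'⟩ := (c i).surj z.1 z.2
    refine ⟨⟨z', ?_⟩, hz'⟩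
    have := (c i).len_apply z'
    rw [hz'] at this
    have := z.2
    omega
  choose f hf using step
  obtain ⟨t, ht⟩ := exists_extending (c := c) j
    (fun i h => (Nat.leRec (motive := fun i _ => {z : (W i).Pos // (W i).len z ≤ k + i})
      ⟨y, hy⟩ (fun i _ z => f i z) h).1) fun i h => by
        rw [Nat.leRec_succ _ _ h]
        exact hf i _
  exact ⟨t, by rw [ht j le_rfl, Nat.leRec_self]⟩

/-- The thread through a given position of the tree number `i`, if that position is short enough
for the thread to be unique. -/
noncomputable def through (i : ℕ) (y : (W i).Pos) (hy : (W i).len y ≤ k + i) : Thread W c :=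
  (exists_apply_eq i y hy).choose

lemma through_apply {i : ℕ} {y : (W i).Pos} (hy : (W i).len y ≤ k + i) :
    (through i y hy : Thread W c).app i = y :=
  (exists_apply_eq i y hy).choose_spec

lemma through_eq {i : ℕ} {y : (W i).Pos} (hy : (W i).len y ≤ k + i) {t : Thread W c}
    (ht : t.app i = y) : through i y hy = t := by
  refine eq_of_apply_eq i ?_ ((through_apply hy).trans ht.symm)
  rw [← len_eq _ i, through_apply hy]
  exact hy

/-- The predecessor of a thread is taken componentwise. -/
def par (t : Thread W c) : Thread W c :=
  ⟨fun i => (W i).par (t.app i), fun i => by rw [(c i).map_par, t.map_app]⟩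

end Thread

variable (W c)

/-- The inverse limit of a sequence of coverings, the `i`-th of which is a `(k + i)`-covering. -/
def limit : PosTree.{u} where
  Pos := Thread W c
  len t := (W 0).len (t.app 0)
  par := Thread.par
  len_par t := (W 0).len_par (t.app 0)
  exists_child t := by
    obtain ⟨y, hy⟩ := (W ((W 0).len (t.app 0) + 1)).exists_child (t.app _)
    have hl : _ = (W 0).len (t.app 0) + 1 := hy.2.trans (congrArg (· + 1) (t.len_eq _))
    obtain ⟨s, hs⟩ := Thread.exists_apply_eq (c := c) _ y (by omega)
    have hs' : (W 0).len (s.app 0) = (W 0).len (t.app 0) + 1 := by rw [← s.len_eq, hs, hl]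
    refine ⟨s, ?_, hs'⟩
    refine Thread.eq_of_apply_eq ((W 0).len (t.app 0) + 1) ?_ ?_
    · change (W 0).len ((W 0).par (s.app 0)) ≤ _
      rw [(W 0).len_par]
      omega
    · change (W _).par (s.app _) = _
      rw [hs, hy.1]

/-- The projection of the inverse limit to one of the trees. -/
def limitProj (i : ℕ) : Hom (limit W c) (W i) :=
  ⟨fun t => t.app i, fun t => t.len_eq i, fun _ => rfl⟩

variable {W}

open Classical in
/-- A strategy on the inverse limit, read as a strategy on the tree number `i` at those positions
that correspond to a unique thread. -/
noncomputable def projStrat (σ : (limit W c).Strat) (i : ℕ) : (W i).Strat where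
  toFun z := if h : (W i).len z ≤ k + i then (σ (Thread.through i z h)).app i
    else (default : (W i).Strat) z
  isChild z := by
    split_ifs with h
    · have := (limitProj W c i).isChild (σ.isChild (Thread.through i z h))
      rwa [show limitProj W c i (Thread.through i z h) = z from Thread.through_apply h] at this
    · exact (default : (W i).Strat).isChild z

variable {c} in
lemma projStrat_apply (σ : (limit W c).Strat) {i : ℕ} {t : Thread W c}
    (h : (W 0).len (t.app 0) ≤ k + i) : projStrat c σ i (t.app i) = (σ t).app i := by
  have h' : (W i).len (t.app i) ≤ k + i := by rwa [t.len_eq]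
  change dite _ _ _ = _
  rw [dif_pos h', Thread.through_eq h' rfl]

/-- Transport a family of strategies one step down along the coverings. Iterating this as an
operation on families gives the transport along a composite of coverings. -/
def stepDown (p : Fin 2) (s : ∀ i, (W i).Strat) (i : ℕ) : (W i).Strat :=
  (c i).strat p (s (i + 1))

lemma stepDown_iterate_agree (p : Fin 2) (n : ℕ) {s s' : ∀ i, (W i).Strat}
    (h : ∀ i, Strat.AgreeBelow p n (s i) (s' i)) (m i : ℕ) :
    Strat.AgreeBelow p n ((stepDown c p)^[m] s i) ((stepDown c p)^[m] s' i) := by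
  induction m generalizing i with
  | zero => exact h i
  | succ m ih =>
    rw [Function.iterate_succ_apply', Function.iterate_succ_apply']
    exact (c i).strat_local p n _ _ (ih (i + 1))

/-- Transport does not change the projected strategies at short positions, by
`Cover.strat_apply`. -/
lemma stepDown_projStrat (p : Fin 2) (σ : (limit W c).Strat) (i : ℕ) :
    Strat.AgreeBelow p (k + i) (stepDown c p (projStrat c σ) i) (projStrat c σ i) := by
  intro z hz hp
  obtain ⟨t, rfl⟩ := Thread.exists_apply_eq (c := c) i z hz.le
  rw [t.len_eq] at hz hp
  rw [projStrat_apply σ hz.le]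
  have h1 : (W (i + 1)).len (t.app (i + 1)) = (W 0).len (t.app 0) := t.len_eq _
  change (c i).strat p (projStrat c σ (i + 1)) (t.app i) = _
  rw [← t.map_app i, (c i).strat_apply p _ _ (by omega) (by omega),
    projStrat_apply σ (by omega), (σ t).map_app i]

lemma stepDown_iterate_succ (p : Fin 2) (σ : (limit W c).Strat) (m i : ℕ) :
    Strat.AgreeBelow p (k + i + m) ((stepDown c p)^[m + 1] (projStrat c σ) i)
      ((stepDown c p)^[m] (projStrat c σ) i) := by
  induction m generalizing i with
  | zero => exact stepDown_projStrat c p σ i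
  | succ m ih =>
    rw [Function.iterate_succ_apply', Function.iterate_succ_apply' _ m]
    refine (c i).strat_local p _ _ _ ?_
    rw [show k + i + (m + 1) = k + (i + 1) + m by omega]
    have := ih (i + 1)
    rwa [Function.iterate_succ_apply'] at this

lemma stepDown_iterate_add (p : Fin 2) (σ : (limit W c).Strat) (m l i : ℕ) :
    Strat.AgreeBelow p (k + i + m) ((stepDown c p)^[m + l] (projStrat c σ) i)
      ((stepDown c p)^[m] (projStrat c σ) i) := by
  induction l with
  | zero => exact Strat.AgreeBelow.refl _ _ _
  | succ l ih =>
    intro z hz hp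
    rw [← ih z hz hp]
    exact stepDown_iterate_succ c p σ (m + l) i z (by omega) hp

/-- The strategy on the tree number `i` obtained from a strategy on the inverse limit: the limit
of the strategies transported down from the trees of larger and larger number, which is eventually
constant at each position. -/
noncomputable def limitStrat (p : Fin 2) (σ : (limit W c).Strat) (i : ℕ) : (W i).Strat :=
  ⟨fun z => (stepDown c p)^[(W i).len z + 1] (projStrat c σ) i z, fun z => Strat.isChild _ z⟩

lemma limitStrat_agree (p : Fin 2) (σ : (limit W c).Strat) (m i : ℕ) :
    Strat.AgreeBelow p (k + i + m) (limitStrat c p σ i)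
      ((stepDown c p)^[m] (projStrat c σ) i) := by
  intro z hz hp
  change (stepDown c p)^[(W i).len z + 1] (projStrat c σ) i z = _
  rcases le_total m ((W i).len z + 1) with h | h
  · obtain ⟨l, hl⟩ := Nat.exists_eq_add_of_le h
    rw [hl]
    exact stepDown_iterate_add c p σ m l i z hz hp
  · obtain ⟨l, hl⟩ := Nat.exists_eq_add_of_le h
    rw [hl]
    exact (stepDown_iterate_add c p σ _ l i z (by omega) hp).symm

lemma limitStrat_eq_strat (p : Fin 2) (σ : (limit W c).Strat) (i : ℕ) (z : (W i).Pos)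
    (hp : (W i).len z % 2 = (p : ℕ)) :
    limitStrat c p σ i z = (c i).strat p (limitStrat c p σ (i + 1)) z := by
  have h1 := limitStrat_agree c p σ ((W i).len z + 1) i z (by omega) hp
  have h2 := (c i).strat_local p _ _ _ (limitStrat_agree c p σ ((W i).len z) (i + 1)) z
    (by omega) hp
  rw [h1, h2, Function.iterate_succ_apply']
  rfl

/-- The play `b` is lifted to each of the trees in turn; these lifts form a branch of threads. -/
lemma limitStrat_lift (p : Fin 2) (σ : (limit W c).Strat) (b : (W 0).Branch)
    (hb : (limitStrat c p σ 0).Consistent p b) :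
    ∃ b' : (limit W c).Branch, σ.Consistent p b' ∧ b'.map (limitProj W c 0) = b := by
  have step : ∀ i (d : {d : (W i).Branch // (limitStrat c p σ i).Consistent p d}),
      ∃ d' : {d : (W (i + 1)).Branch // (limitStrat c p σ (i + 1)).Consistent p d},
        d'.1.map (c i).toHom = d.1 := fun i d => by
    obtain ⟨d', hd', h⟩ := (c i).lift p (limitStrat c p σ (i + 1)) d.1 fun n hn => by
      rw [d.2 n hn, limitStrat_eq_strat c p σ i _ (by rwa [d.1.len_apply])]
    exact ⟨⟨d', hd'⟩, h⟩
  choose f hf using step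
  let B : ∀ i, {d : (W i).Branch // (limitStrat c p σ i).Consistent p d} :=
    fun i => Nat.rec ⟨b, hb⟩ f i
  have hB : ∀ i n, (c i).toFun ((B (i + 1)).1 n) = (B i).1 n := fun i n =>
    congrArg (fun d : (W i).Branch => d n) (hf i (B i))
  refine ⟨⟨fun n => ⟨fun i => (B i).1 n, fun i => hB i n⟩, fun n => b.len_apply n,
    fun n => Thread.ext (funext fun i => (B i).1.par_apply n)⟩, fun n hn => ?_, rfl⟩
  refine Thread.eq_of_apply_eq (n + 1) ?_ ?_
  · change (W 0).len (b (n + 1)) ≤ _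
    rw [b.len_apply]; omega
  · change (B (n + 1)).1 (n + 1) = _
    have hl := (B (n + 1)).1.len_apply n
    rw [(B (n + 1)).2 n hn, limitStrat_agree c p σ 0 (n + 1) _ (by omega) (by rwa [hl])]
    refine projStrat_apply σ (t := ⟨fun i => (B i).1 n, fun i => hB i n⟩) ?_
    change (W 0).len (b n) ≤ _
    rw [b.len_apply]; omega

/-- The inverse limit of a sequence of coverings covers the first tree. -/
noncomputable def limitCover : Cover k (limit W c) (W 0) where
  toHom := limitProj W c 0
  strat p σ := limitStrat c p σ 0
  strat_local p n σ σ' h z hz hp := by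
    refine stepDown_iterate_agree c p n (fun i y hy hyp => ?_) _ 0 z hz hp
    change dite _ _ _ = dite _ _ _
    split_ifs with hl
    · have := (Thread.through (c := c) i y hl).len_eq i
      rw [Thread.through_apply] at this
      rw [h (Thread.through i y hl) (this ▸ hy) (this ▸ hyp)]
    · rfl
  inj y z hy h := Thread.eq_of_apply_eq 0 hy h
  surj x hx := Thread.exists_apply_eq 0 x hx
  strat_apply p σ y hy hp := by
    change limitStrat c p σ 0 (y.app 0) = (σ y).1 0
    rw [limitStrat_agree c p σ 0 0 _ hy hp]
    exact projStrat_apply σ (i := 0) (le_of_lt hy)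
  lift := limitStrat_lift c

lemma limitProj_map (i : ℕ) (b : (limit W c).Branch) :
    (b.map (limitProj W c (i + 1))).map (c i).toHom = b.map (limitProj W c i) :=
  Branch.ext fun n => (b n).map_app i

end Limit

variable {X : PosTree.{u}}

/-! ### The unraveling tree of an open set -/

section Unravel

variable (N : ℕ) (D : Set X.Pos)

/-- The positions comparable with `u`. -/
def cone (u : X.Pos) : Set X.Pos :=
  {z | X.trunc (X.len z) u = z ∨ X.trunc (X.len u) z = u}

/-- `s` is a quasi-strategy of player `0` in the game continuing from the position `y` of length
`N + 1`: it allows every move of player `1` and at least one move of player `0`. It is not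
required to be closed under predecessors. -/
def IsQuasi (s : Set X.Pos) (y : X.Pos) : Prop :=
  y ∈ s ∧ ∀ z ∈ s, N + 1 ≤ X.len z →
    (X.len z % 2 = 1 → ∀ w, X.IsChild w z → w ∈ s) ∧
    (X.len z % 2 = 0 → ∃ w, X.IsChild w z ∧ w ∈ s)

/-- The replies `c` of player `1`, who has just moved to the position `y` of length `N + 2`, to
the quasi-strategy `s`: either `c` is the set of positions comparable with a position `u ∈ s ∩ D`,
to be reached from now on, or `c` is a quasi-strategy of player `1` inside `s` that avoids `D`. -/
def IsReply (s c : Set X.Pos) (y : X.Pos) : Prop :=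
  (∃ u ∈ s, u ∈ D ∧ N + 2 ≤ X.len u ∧ X.trunc (N + 2) u = y ∧ c = cone u) ∨
  (y ∈ c ∧ c ⊆ s ∧ ∀ z ∈ c, N + 2 ≤ X.len z → z ∉ D ∧
    (X.len z % 2 = 0 → ∀ w, X.IsChild w z → w ∈ s → w ∈ c) ∧
    (X.len z % 2 = 1 → ∃ w, X.IsChild w z ∧ w ∈ c))

/-- The positions of the unraveling tree: a position `x` of `X`, the quasi-strategy announced at
length `N + 1` and the reply given at length `N + 2`. Before these are announced, they are `univ`
by convention. From length `N + 2` on, the play has to stay inside the reply. -/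
structure Legal (t : X.Pos × Set X.Pos × Set X.Pos) : Prop where
  left_eq : X.len t.1 ≤ N → t.2.1 = univ
  quasi : N + 1 ≤ X.len t.1 → IsQuasi N t.2.1 (X.trunc (N + 1) t.1)
  right_eq : X.len t.1 ≤ N + 1 → t.2.2 = univ
  reply : N + 2 ≤ X.len t.1 → IsReply N D t.2.1 t.2.2 (X.trunc (N + 2) t.1)
  mem : ∀ m, N + 2 ≤ m → m ≤ X.len t.1 → X.trunc m t.1 ∈ t.2.2

open Classical in
/-- The position `x` with the announcements `s` and `c`, as far as these have been made when `x`
is reached. -/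
noncomputable def pos (x : X.Pos) (s c : Set X.Pos) : X.Pos × Set X.Pos × Set X.Pos :=
  (x, if X.len x ≤ N then univ else s, if X.len x ≤ N + 1 then univ else c)

/-- The predecessor of a position of the unraveling tree. -/
noncomputable def rpar (t : X.Pos × Set X.Pos × Set X.Pos) : X.Pos × Set X.Pos × Set X.Pos :=
  pos N (X.par t.1) t.2.1 t.2.2

variable {N D}

@[simp] lemma pos_fst (x : X.Pos) (s c : Set X.Pos) : (pos N x s c).1 = x := rfl

lemma legal_pos {x : X.Pos} {s c : Set X.Pos}
    (h1 : N + 1 ≤ X.len x → IsQuasi N s (X.trunc (N + 1) x))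
    (h2 : N + 2 ≤ X.len x → IsReply N D s c (X.trunc (N + 2) x))
    (h3 : ∀ m, N + 2 ≤ m → m ≤ X.len x → X.trunc m x ∈ c) : Legal N D (pos N x s c) where
  left_eq h := if_pos h
  quasi h := by
    change IsQuasi N (ite _ _ _) _
    rw [if_neg (by rw [pos_fst] at h; omega)]
    exact h1 h
  right_eq h := if_pos h
  reply h := by
    change IsReply N D (ite _ _ _) (ite _ _ _) _
    rw [pos_fst] at h
    rw [if_neg (by omega), if_neg (by omega)]
    exact h2 h
  mem m hm h := by
    change _ ∈ ite _ _ _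
    rw [pos_fst] at h
    rw [if_neg (by omega)]
    exact h3 m hm h

lemma Legal.eq_pos {t : X.Pos × Set X.Pos × Set X.Pos} (h : Legal N D t) :
    t = pos N t.1 t.2.1 t.2.2 := by
  refine Prod.ext rfl (Prod.ext ?_ ?_)
  · change _ = ite _ _ _
    split_ifs with h'
    exacts [h.left_eq h', rfl]
  · change _ = ite _ _ _
    split_ifs with h'
    exacts [h.right_eq h', rfl]

lemma rpar_pos (x : X.Pos) (s c : Set X.Pos) : rpar N (pos N x s c) = pos N (X.par x) s c := by
  have := X.len_par x
  refine Prod.ext rfl (Prod.ext ?_ ?_)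
  · change ite _ _ (ite _ _ _) = ite _ _ _
    by_cases h : X.len (X.par x) ≤ N
    · exact (if_pos h).trans (if_pos h).symm
    · exact ((if_neg h).trans (if_neg (by omega))).trans (if_neg h).symm
  · change ite _ _ (ite _ _ _) = ite _ _ _
    by_cases h : X.len (X.par x) ≤ N + 1
    · exact (if_pos h).trans (if_pos h).symm
    · exact ((if_neg h).trans (if_neg (by omega))).trans (if_neg h).symm

lemma pos_of_len_le {x : X.Pos} (h : X.len x ≤ N) (s c s' c' : Set X.Pos) :
    pos N x s c = pos N x s' c' := by
  rw [pos, pos, if_pos h, if_pos h, if_pos (by omega), if_pos (by omega)]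

lemma pos_of_len_le_succ {x : X.Pos} (h : X.len x ≤ N + 1) (s c c' : Set X.Pos) :
    pos N x s c = pos N x s c' := by
  rw [pos, pos, if_pos h, if_pos h]

lemma legal_of_len_le {x : X.Pos} (h : X.len x ≤ N) (s c : Set X.Pos) :
    Legal N D (pos N x s c) :=
  legal_pos (fun h' => by omega) (fun h' => by omega) fun m hm h' => by omega

lemma Legal.rpar {t : X.Pos × Set X.Pos × Set X.Pos} (h : Legal N D t) :
    Legal N D (rpar N t) := by
  have hl := X.len_par t.1
  refine legal_pos (fun h' => ?_) (fun h' => ?_) fun m hm h' => ?_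
  · rw [trunc_par (by omega)]; exact h.quasi (by omega)
  · rw [trunc_par (by omega)]; exact h.reply (by omega)
  · rw [trunc_par (by omega)]; exact h.mem m hm (by omega)

lemma trunc_mem_cone (m : ℕ) (u : X.Pos) : X.trunc m u ∈ cone u := by
  left
  rw [X.len_trunc]
  rcases le_total m (X.len u) with h | h
  · rw [min_eq_left h]
  · rw [min_eq_right h, trunc_of_len_le le_rfl, trunc_of_len_le h]

lemma eq_trunc_of_mem_cone {z u : X.Pos} (h : z ∈ cone u) (hl : X.len z ≤ X.len u) :
    z = X.trunc (X.len z) u := by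
  rcases h with h | h
  · exact h.symm
  · rw [trunc_of_len_le hl] at h
    rw [h, trunc_of_len_le le_rfl]

lemma Branch.mem_cone (b : X.Branch) (m n : ℕ) : b n ∈ cone (b m) := by
  rcases le_total n m with h | h
  · left; rw [b.len_apply, b.trunc_apply, min_eq_left h]
  · right; rw [b.len_apply, b.trunc_apply, min_eq_left h]

lemma trunc_isChild {m : ℕ} {u : X.Pos} (h : m < X.len u) :
    X.IsChild (X.trunc (m + 1) u) (X.trunc m u) := by
  refine ⟨?_, ?_⟩
  · rw [trunc, trunc, ← Function.iterate_succ_apply' X.par]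
    congr 1; omega
  · rw [X.len_trunc, X.len_trunc]; omega

/-- Extending a legal position by one move that keeps the announcements. -/
lemma Legal.pos_child {x y : X.Pos} {s c : Set X.Pos} (h : Legal N D (x, s, c))
    (hx : N + 2 ≤ X.len x) (hy : X.IsChild y x) (hyc : y ∈ c) : Legal N D (pos N y s c) := by
  refine legal_pos (fun _ => ?_) (fun _ => ?_) fun m hm h' => ?_
  · rw [hy.trunc (by omega)]; exact h.quasi (by simp only; omega)
  · rw [hy.trunc (by omega)]; exact h.reply hx
  · rcases Nat.lt_or_ge (X.len x) m with h1 | h1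
    · rwa [trunc_of_len_le (by rw [hy.2]; omega)]
    · rw [hy.trunc h1]; exact h.mem m hm h1

/-- At every position of length at least `N + 2` there is a move that stays inside the reply. -/
lemma Legal.exists_child_mem {x : X.Pos} {s c : Set X.Pos} (h : Legal N D (x, s, c))
    (hx : N + 2 ≤ X.len x) : ∃ y, X.IsChild y x ∧ y ∈ c := by
  have hxc : x ∈ c := by
    have := h.mem _ hx le_rfl
    rwa [trunc_of_len_le le_rfl] at this
  rcases h.reply hx with ⟨u, -, -, -, -, rfl⟩ | ⟨-, hcs, hc⟩
  · rcases Nat.lt_or_ge (X.len x) (X.len u) with hl | hl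
    · refine ⟨X.trunc (X.len x + 1) u, ?_, trunc_mem_cone _ _⟩
      have := trunc_isChild hl
      rwa [← eq_trunc_of_mem_cone hxc hl.le] at this
    · obtain ⟨y, hy⟩ := X.exists_isChild x
      refine ⟨y, hy, Or.inr ?_⟩
      rw [hy.trunc hl]
      rcases hxc with h | h
      · rw [trunc_of_len_le hl] at h
        rw [← h, trunc_of_len_le le_rfl]
      · exact h
  · obtain ⟨-, hc0, hc1⟩ := hc x hxc hx
    rcases Nat.mod_two_eq_zero_or_one (X.len x) with h0 | h1
    · obtain ⟨w, hw, hws⟩ := ((h.quasi (by simp only; omega)).2 x (hcs hxc) (by omega)).2 h0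
      exact ⟨w, hw, hc0 h0 w hw hws⟩
    · exact hc1 h1

/-- The unraveling tree has no leaves. For the reply at length `N + 2`: if `s` contains a position
of `D`, this can be announced; otherwise `s` itself avoids `D`. -/
lemma Legal.exists_child (hN : N % 2 = 0) {t : X.Pos × Set X.Pos × Set X.Pos}
    (h : Legal N D t) : ∃ t', Legal N D t' ∧ PosTree.rpar N t' = t ∧ X.IsChild t'.1 t.1 := by
  suffices ∃ y s c, X.IsChild y t.1 ∧ Legal N D (pos N y s c) ∧ pos N t.1 s c = t by
    obtain ⟨y, s, c, hy, hl, he⟩ := this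
    exact ⟨_, hl, by rw [rpar_pos, hy.1, he], hy⟩
  obtain ⟨x, s, c⟩ := t
  have he := h.eq_pos
  dsimp only at he ⊢
  rcases Nat.lt_trichotomy (X.len x) (N + 1) with hx | hx | hx
  · obtain ⟨y, hy⟩ := X.exists_isChild x
    refine ⟨y, univ, univ, hy, legal_pos (fun _ => ⟨mem_univ _, fun z _ _ => ⟨fun _ _ _ =>
      mem_univ _, fun _ => ?_⟩⟩) (fun h' => ?_) fun _ _ _ => mem_univ _, ?_⟩
    · obtain ⟨w, hw⟩ := X.exists_isChild z
      exact ⟨w, hw, mem_univ _⟩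
    · have := hy.2; omega
    · rw [he]; exact pos_of_len_le (by omega) _ _ _ _
  · have hq : IsQuasi N s x := by
      have := h.quasi (by simp only; omega)
      rwa [trunc_of_len_le hx.le] at this
    by_cases hu : ∃ u ∈ s, u ∈ D ∧ N + 2 ≤ X.len u ∧ X.trunc (N + 1) u = x
    · obtain ⟨u, hus, huD, hul, hux⟩ := hu
      have hy : X.IsChild (X.trunc (N + 2) u) x := by
        have := trunc_isChild (X := X) (m := N + 1) (u := u) (by omega)
        rwa [hux] at this
      have hyl := hy.2
      refine ⟨X.trunc (N + 2) u, s, cone u, hy, legal_pos (fun _ => ?_) (fun _ => ?_)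
        fun m hm h' => ?_, ?_⟩
      · rwa [hy.trunc hx.ge, trunc_of_len_le hx.le]
      · rw [trunc_trunc le_rfl]
        exact Or.inl ⟨u, hus, huD, hul, rfl, rfl⟩
      · rw [trunc_of_len_le (by omega)]
        exact trunc_mem_cone _ _
      · rw [he]; exact pos_of_len_le_succ hx.le _ _ _
    · obtain ⟨y, hy⟩ := X.exists_isChild x
      have hyl := hy.2
      have hyx : X.trunc (N + 1) y = x := by rw [hy.trunc hx.ge, trunc_of_len_le hx.le]
      have hys : y ∈ s := (hq.2 x hq.1 hx.ge).1 (by omega) y hy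
      have hmem : y ∈ {z | z ∈ s ∧ N + 2 ≤ X.len z ∧ X.trunc (N + 1) z = x} :=
        ⟨hys, by omega, hyx⟩
      refine ⟨y, s, {z | z ∈ s ∧ N + 2 ≤ X.len z ∧ X.trunc (N + 1) z = x}, hy,
        legal_pos (fun _ => by rwa [hyx]) (fun _ => ?_) fun m hm h' => ?_, ?_⟩
      · rw [trunc_of_len_le (by omega)]
        refine Or.inr ⟨hmem, fun z hz => hz.1, fun z ⟨hzs, hzl, hzx⟩ _ =>
          ⟨fun hzD => hu ⟨z, hzs, hzD, hzl, hzx⟩, fun _ w hw hws => ?_, fun hz1 => ?_⟩⟩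
        · exact ⟨hws, by rw [hw.2]; omega, by rw [hw.trunc (by omega), hzx]⟩
        · obtain ⟨w, hw⟩ := X.exists_isChild z
          exact ⟨w, hw, (hq.2 z hzs (by omega)).1 hz1 w hw, by rw [hw.2]; omega,
            by rw [hw.trunc (by omega), hzx]⟩
      · rwa [trunc_of_len_le (by omega)]
      · rw [he]; exact pos_of_len_le_succ hx.le _ _ _
  · obtain ⟨y, hy, hyc⟩ := h.exists_child_mem hx
    exact ⟨y, s, c, hy, h.pos_child hx hy hyc, he.symm⟩

variable (N D)

/-- The unraveling tree of the set of branches through `D`: at length `N` player `0` announces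
a quasi-strategy together with the move, and player `1` replies to it as in `IsReply`. The length
`N` is even, so that it is the turn of player `0`. -/
noncomputable def unravel (hN : N % 2 = 0) : PosTree.{u} where
  Pos := {t : X.Pos × Set X.Pos × Set X.Pos // Legal N D t}
  len t := X.len t.1.1
  par t := ⟨rpar N t.1, t.2.rpar⟩
  len_par t := X.len_par t.1.1
  exists_child t := by
    obtain ⟨t', ht', hp, hc⟩ := t.2.exists_child hN
    exact ⟨⟨t', ht'⟩, Subtype.ext hp, hc.2⟩

variable {N D} {hN : N % 2 = 0}

open Classical in
/-- The answer of a strategy on the unraveling tree at the position `t`, and an arbitrary move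
if `t` is not a position of the unraveling tree. -/
noncomputable def ans (σ : (unravel N D hN).Strat) (t : X.Pos × Set X.Pos × Set X.Pos) :
    X.Pos × Set X.Pos × Set X.Pos :=
  if h : Legal N D t then (σ ⟨t, h⟩).1 else ((default : X.Strat) t.1, univ, univ)

lemma ans_isChild (σ : (unravel N D hN).Strat) (t : X.Pos × Set X.Pos × Set X.Pos) :
    X.IsChild (ans σ t).1 t.1 := by
  rw [ans]
  split_ifs with h
  · have := σ.isChild ⟨t, h⟩
    exact ⟨congrArg (fun z => z.1.1) this.1, this.2⟩
  · exact (default : X.Strat).isChild _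

lemma ans_legal (σ : (unravel N D hN).Strat) {t : X.Pos × Set X.Pos × Set X.Pos}
    (h : Legal N D t) : Legal N D (ans σ t) := by
  rw [ans, dif_pos h]
  exact (σ ⟨t, h⟩).2

lemma rpar_ans (σ : (unravel N D hN).Strat) {t : X.Pos × Set X.Pos × Set X.Pos}
    (h : Legal N D t) : rpar N (ans σ t) = t := by
  rw [ans, dif_pos h]
  exact congrArg Subtype.val (σ.isChild ⟨t, h⟩).1

lemma ans_congr {p : Fin 2} {n : ℕ} {σ σ' : (unravel N D hN).Strat}
    (h : Strat.AgreeBelow p n σ σ') {t : X.Pos × Set X.Pos × Set X.Pos} (ht : X.len t.1 < n)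
    (hp : X.len t.1 % 2 = (p : ℕ)) : ans σ t = ans σ' t := by
  rw [ans, ans]
  split_ifs with hl
  · rw [h ⟨t, hl⟩ ht hp]
  · rfl

/-- An answer of player `0` at length `N` leaves only the reply open. -/
lemma ans_eq_pos_left (σ : (unravel N D hN).Strat) {x : X.Pos} {s c : Set X.Pos}
    (hx : X.len x = N) (c' : Set X.Pos) :
    ans σ (pos N x s c) = pos N (ans σ (pos N x s c)).1 (ans σ (pos N x s c)).2.1 c' := by
  have h := ans_legal σ (legal_of_len_le (D := D) hx.le s c)
  have hl := (ans_isChild σ (pos N x s c)).2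
  rw [pos_fst] at hl
  exact h.eq_pos.trans (pos_of_len_le_succ (by omega) _ _ _)

/-- The first announcement is not changed by later answers. -/
lemma ans_left (σ : (unravel N D hN).Strat) {x : X.Pos} {s c : Set X.Pos}
    (h : Legal N D (pos N x s c)) (hx : N + 1 ≤ X.len x) : (ans σ (pos N x s c)).2.1 = s := by
  have := congrArg (fun t => t.2.1) (rpar_ans σ h)
  have hc : X.par _ = x := (ans_isChild σ (pos N x s c)).1
  change ite _ _ _ = ite _ _ _ at this
  rwa [hc, if_neg (by omega), if_neg (by omega)] at this

/-- The reply is not changed by later answers. -/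
lemma ans_right (σ : (unravel N D hN).Strat) {x : X.Pos} {s c : Set X.Pos}
    (h : Legal N D (pos N x s c)) (hx : N + 2 ≤ X.len x) : (ans σ (pos N x s c)).2.2 = c := by
  have := congrArg (fun t => t.2.2) (rpar_ans σ h)
  have hc : X.par _ = x := (ans_isChild σ (pos N x s c)).1
  change ite _ _ _ = ite _ _ _ at this
  rwa [hc, if_neg (by omega), if_neg (by omega)] at this

lemma ans_eq_pos (σ : (unravel N D hN).Strat) {x : X.Pos} {s c : Set X.Pos}
    (h : Legal N D (pos N x s c)) (hx : X.len x < N ∨ N + 2 ≤ X.len x) :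
    ans σ (pos N x s c) = pos N (ans σ (pos N x s c)).1 s c := by
  have hl := (ans_isChild σ (pos N x s c)).2
  rw [pos_fst] at hl
  have he := (ans_legal σ h).eq_pos
  rcases hx with hx | hx
  · exact he.trans (pos_of_len_le (by omega) _ _ _ _)
  · rwa [ans_left σ h (by omega), ans_right σ h hx] at he

lemma ans_mem (σ : (unravel N D hN).Strat) {x : X.Pos} {s c : Set X.Pos}
    (h : Legal N D (pos N x s c)) (hx : N + 2 ≤ X.len x) : (ans σ (pos N x s c)).1 ∈ c := by
  have hl := (ans_isChild σ (pos N x s c)).2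
  rw [pos_fst] at hl
  have := (ans_legal σ h).mem _ (show N + 2 ≤ X.len x + 1 by omega) hl.ge
  rwa [trunc_of_len_le hl.le, ans_right σ h hx] at this

lemma Branch.legal (b : X.Branch) {s c : Set X.Pos} {n : ℕ}
    (h1 : N + 1 ≤ n → IsQuasi N s (b (N + 1)))
    (h2 : N + 2 ≤ n → IsReply N D s c (b (N + 2)))
    (h3 : ∀ m, N + 2 ≤ m → m ≤ n → b m ∈ c) : Legal N D (pos N (b n) s c) := by
  refine legal_pos (fun h => ?_) (fun h => ?_) fun m hm h => ?_ <;> rw [b.len_apply] at h <;>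
    rw [b.trunc_apply, min_eq_left h]
  exacts [h1 h, h2 h, h3 m hm h]

/-- The branch of the unraveling tree given by a branch of `X` and the two announcements. -/
noncomputable def Branch.unravel (b : X.Branch) (s c : Set X.Pos)
    (h : ∀ n, Legal N D (pos N (b n) s c)) : (PosTree.unravel N D hN).Branch where
  toFun n := ⟨pos N (b n) s c, h n⟩
  len_apply n := b.len_apply n
  par_apply n := Subtype.ext <| by
    change rpar N (pos N (b (n + 1)) s c) = pos N (b n) s c
    rw [rpar_pos, b.par_apply]

variable (N D hN) in
/-- The projection of the unraveling tree, forgetting the announcements. -/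
noncomputable def unravelProj : Hom (unravel N D hN) X :=
  ⟨fun t => t.1.1, fun _ => rfl, fun _ => rfl⟩

/-- A lift of `b` is consistent with `σ` if the answers of `σ` give the moves of `b`, except that
the announcements at lengths `N` and `N + 1` have to be the right ones, too. -/
lemma exists_lift (p : Fin 2) (σ : (unravel N D hN).Strat) (b : X.Branch) (s c : Set X.Pos)
    (h : ∀ n, Legal N D (pos N (b n) s c))
    (hans : ∀ n, n % 2 = (p : ℕ) → n < N ∨ N + 2 ≤ n → b (n + 1) = (ans σ (pos N (b n) s c)).1)
    (hans' : ∀ n, n % 2 = (p : ℕ) → n = N ∨ n = N + 1 →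
      ans σ (pos N (b n) s c) = pos N (b (n + 1)) s c) :
    ∃ b' : (unravel N D hN).Branch, σ.Consistent p b' ∧ b'.map (unravelProj N D hN) = b := by
  refine ⟨b.unravel s c h, fun n hn => Subtype.ext ?_, rfl⟩
  have : ans σ (pos N (b n) s c) = pos N (b (n + 1)) s c := by
    by_cases hn' : n < N ∨ N + 2 ≤ n
    · rw [hans n hn hn', ← ans_eq_pos σ (h n) (by rwa [b.len_apply])]
    · exact hans' n hn (by omega)
  rw [ans, dif_pos (h n)] at this
  exact this.symm

/-! ### Transfer of strategies from the unraveling tree -/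

open Classical in
/-- The move at `x` of player `p`, who tries to reach `U`. Once a position `u ∈ U` has been reached,
the move is that of `σ` in the play with announcements `S u` and `cone u`. Before that, as soon as
reaching `U` can be forced, it is a move forcing it. As long as it cannot be forced, the move is
that of `σ` in the play with announcements `s` and `c`. -/
noncomputable def follow (p : Fin 2) (σ : (unravel N D hN).Strat) (U : Set X.Pos)
    (S : X.Pos → Set X.Pos) (s c : Set X.Pos) (x : X.Pos) : X.Pos :=
  if h : ∃ m, X.trunc m x ∈ U then
    (ans σ (pos N x (S (X.trunc (Nat.find h) x)) (cone (X.trunc (Nat.find h) x)))).1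
  else if h : ∃ m, N + 1 ≤ m ∧ X.trunc m x ∈ X.Win p U then
    winStrat p U (X.trunc (Nat.find h) x) x
  else (ans σ (pos N x s c)).1

lemma follow_isChild (p : Fin 2) (σ : (unravel N D hN).Strat) (U : Set X.Pos)
    (S : X.Pos → Set X.Pos) (s c : Set X.Pos) (x : X.Pos) :
    X.IsChild (follow p σ U S s c x) x := by
  rw [follow]
  split_ifs
  · exact ans_isChild σ _
  · exact Strat.isChild _ _
  · exact ans_isChild σ _

lemma follow_congr {p : Fin 2} {n : ℕ} {σ σ' : (unravel N D hN).Strat}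
    (h : Strat.AgreeBelow p n σ σ') (U : Set X.Pos) (S : X.Pos → Set X.Pos) (s c : Set X.Pos)
    {x : X.Pos} (hx : X.len x < n) (hp : X.len x % 2 = (p : ℕ)) :
    follow p σ U S s c x = follow p σ' U S s c x := by
  rw [follow, follow]
  split_ifs
  · rw [ans_congr h hx hp]
  · rfl
  · rw [ans_congr h hx hp]

/-- A play in which player `p` moves according to `follow` either passes through `U`, and from
then on follows `σ`, or reaching `U` cannot be forced at any time, and the play always follows
`σ`. -/
lemma follow_cases {p : Fin 2} {σ : (unravel N D hN).Strat} {U : Set X.Pos}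
    {S : X.Pos → Set X.Pos} {s c : Set X.Pos} (hU : ∀ u ∈ U, N + 2 ≤ X.len u) {b : X.Branch}
    (hb : ∀ n, N + 1 ≤ n → n % 2 = (p : ℕ) → b (n + 1) = follow p σ U S s c (b n)) :
    (∃ m, b m ∈ U ∧ ∀ n, m ≤ n → n % 2 = (p : ℕ) →
      b (n + 1) = (ans σ (pos N (b n) (S (b m)) (cone (b m)))).1) ∨
    ((∀ n, N + 1 ≤ n → b n ∉ X.Win p U) ∧
      ∀ n, N + 1 ≤ n → n % 2 = (p : ℕ) → b (n + 1) = (ans σ (pos N (b n) s c)).1) := by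
  classical
  by_cases h1 : ∃ m, b m ∈ U
  · left
    refine ⟨Nat.find h1, Nat.find_spec h1, fun n hn hp => ?_⟩
    have hl := hU _ (Nat.find_spec h1)
    rw [b.len_apply] at hl
    have h : ∃ m, X.trunc m (b n) ∈ U :=
      ⟨Nat.find h1, by rw [b.trunc_apply, min_eq_left hn]; exact Nat.find_spec h1⟩
    have hf : Nat.find h = Nat.find h1 := by
      refine (Nat.find_eq_iff h).2 ⟨?_, fun m hm => ?_⟩
      · rw [b.trunc_apply, min_eq_left hn]; exact Nat.find_spec h1
      · rw [b.trunc_apply]; exact Nat.find_min h1 (by omega)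
    rw [hb n (by omega) hp, follow, dif_pos h, hf, b.trunc_apply, min_eq_left hn]
  · right
    have h1' : ∀ n, ¬ ∃ m, X.trunc m (b n) ∈ U := fun n ⟨m, hm⟩ =>
      h1 ⟨_, by rwa [b.trunc_apply] at hm⟩
    by_cases h2 : ∃ m, N + 1 ≤ m ∧ b m ∈ X.Win p U
    · obtain ⟨hl, hw⟩ := Nat.find_spec h2
      refine absurd (winStrat_spec hw b (by rw [b.len_apply]) fun n hn hp => ?_) h1
      rw [b.len_apply] at hn
      have h : ∃ m, N + 1 ≤ m ∧ X.trunc m (b n) ∈ X.Win p U :=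
        ⟨Nat.find h2, hl, by rwa [b.trunc_apply, min_eq_left hn]⟩
      have hf : Nat.find h = Nat.find h2 := by
        refine (Nat.find_eq_iff h).2 ⟨⟨hl, ?_⟩, fun m hm => ?_⟩
        · rwa [b.trunc_apply, min_eq_left hn]
        · rw [b.trunc_apply, min_eq_left (by omega)]; exact Nat.find_min h2 hm
      rw [hb n (by omega) hp, follow, dif_neg (h1' n), dif_pos h, hf, b.trunc_apply,
        min_eq_left hn]
    · refine ⟨fun n hn h => h2 ⟨n, hn, h⟩, fun n hn hp => ?_⟩
      rw [hb n hn hp, follow, dif_neg (h1' n), dif_neg]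
      rintro ⟨m, hm, h⟩
      rw [b.trunc_apply] at h
      exact h2 ⟨_, by omega, h⟩

variable (N D) in
/-- The positions that player `0` tries to reach after announcing `s`. -/
def target₀ (s : Set X.Pos) : Set X.Pos := {u | u ∈ s ∧ u ∈ D ∧ N + 2 ≤ X.len u}

variable (N D) in
/-- A position `u` that player `1` may announce at `y`, in answer to the quasi-strategy `s`. Here
`g s` is the answer to `s`. -/
def IsWitness (g : Set X.Pos → X.Pos × Set X.Pos × Set X.Pos) (y u : X.Pos) (s : Set X.Pos) :
    Prop :=
  u ∈ s ∧ u ∈ D ∧ N + 2 ≤ X.len u ∧ IsQuasi N s y ∧ g s = (X.trunc (N + 2) u, s, cone u)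

variable (N D) in
/-- The positions that player `1` tries to reach: those announced in answer to some
quasi-strategy. -/
def target₁ (g : Set X.Pos → X.Pos × Set X.Pos × Set X.Pos) (y : X.Pos) : Set X.Pos :=
  {u | ∃ s, IsWitness N D g y u s}

open Classical in
variable (N D) in
/-- A quasi-strategy in answer to which player `1` announces `u`. -/
noncomputable def witness (g : Set X.Pos → X.Pos × Set X.Pos × Set X.Pos) (y u : X.Pos) :
    Set X.Pos :=
  if h : ∃ s, IsWitness N D g y u s then h.choose else univ

/-- `follow` for player `0`, where `s` is the quasi-strategy announced. -/
noncomputable def follow₀ (σ : (unravel N D hN).Strat) (s : Set X.Pos) (x : X.Pos) : X.Pos :=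
  follow 0 σ (target₀ N D s) (fun _ => s) s (s ∩ (X.Win 0 (target₀ N D s))ᶜ) x

/-- `follow` for player `1`, where `y` is the position of length `N + 1` and `g` gives the answers
to all quasi-strategies. As long as the target cannot be forced, player `0` is imagined to have
announced the quasi-strategy of avoiding the positions from which it can. -/
noncomputable def follow₁ (σ : (unravel N D hN).Strat)
    (g : Set X.Pos → X.Pos × Set X.Pos × Set X.Pos) (y x : X.Pos) : X.Pos :=
  follow 1 σ (target₁ N D g y) (witness N D g y) (X.Win 1 (target₁ N D g y))ᶜ
    (g (X.Win 1 (target₁ N D g y))ᶜ).2.2 x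

open Classical in
/-- The strategy on `X` obtained from a strategy on the unraveling tree. -/
noncomputable def unravelStrat (p : Fin 2) (σ : (unravel N D hN).Strat) : X.Strat where
  toFun x :=
    if X.len x ≤ N then (ans σ (pos N x univ univ)).1
    else if p = 0 then follow₀ σ (ans σ (pos N (X.trunc N x) univ univ)).2.1 x
    else follow₁ σ (fun s => ans σ (pos N (X.trunc (N + 1) x) s univ)) (X.trunc (N + 1) x) x
  isChild x := by
    split_ifs
    · exact ans_isChild σ _
    · exact follow_isChild _ _ _ _ _ _ _
    · exact follow_isChild _ _ _ _ _ _ _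

lemma unravelStrat_local (p : Fin 2) (n : ℕ) (σ σ' : (unravel N D hN).Strat)
    (h : Strat.AgreeBelow p n σ σ') :
    Strat.AgreeBelow p n (unravelStrat p σ) (unravelStrat p σ') := by
  intro x hx hp
  change ite _ _ _ = ite _ _ _
  split_ifs with h1 h2
  · rw [ans_congr h hx hp]
  · subst h2
    have hl : X.len (X.trunc N x) = N := by rw [X.len_trunc]; omega
    rw [ans_congr h (t := pos N (X.trunc N x) univ univ) (by rw [pos_fst, hl]; omega)
      (by rw [pos_fst, hl, hN]; rfl)]
    exact follow_congr h _ _ _ _ hx hp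
  · have hp1 : (p : ℕ) = 1 := by omega
    have hl : X.len (X.trunc (N + 1) x) = N + 1 := by rw [X.len_trunc]; omega
    have hg : (fun s => ans σ (pos N (X.trunc (N + 1) x) s univ)) =
        fun s => ans σ' (pos N (X.trunc (N + 1) x) s univ) := funext fun s =>
      ans_congr h (by rw [pos_fst, hl]; omega) (by rw [pos_fst, hl]; omega)
    have hp' : p = 1 := Fin.ext hp1
    subst hp'
    rw [hg]
    exact follow_congr h _ _ _ _ hx hp

/-- A move according to `σ` inside `cone u`, at a position before `u`, goes towards `u`. -/
lemma ans_fst_of_lt (σ : (unravel N D hN).Strat) {b : X.Branch} {s : Set X.Pos} {m n : ℕ}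
    (h : Legal N D (pos N (b n) s (cone (b m)))) (hn : N + 2 ≤ n) (hm : n < m) :
    (ans σ (pos N (b n) s (cone (b m)))).1 = b (n + 1) := by
  have hl := (ans_isChild σ (pos N (b n) s (cone (b m)))).2
  rw [pos_fst, b.len_apply] at hl
  have := eq_trunc_of_mem_cone (ans_mem σ h (by rwa [b.len_apply])) (by rw [hl, b.len_apply]; omega)
  rwa [hl, b.trunc_apply, min_eq_left (by omega)] at this

/-- If the play reaches a position `u ∈ s ∩ D`, it lifts to the play in which player `1` announced
`u`. Otherwise player `0` could never force this, and the play lifts to the one in which player `1`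
replied with the quasi-strategy of preventing player `0` from forcing it. -/
lemma unravelStrat_lift₀ (σ : (unravel N D hN).Strat) (b : X.Branch)
    (hb : (unravelStrat 0 σ).Consistent 0 b) :
    ∃ b' : (unravel N D hN).Branch, σ.Consistent 0 b' ∧ b'.map (unravelProj N D hN) = b := by
  have hlow : ∀ n, n % 2 = 0 → n ≤ N → b (n + 1) = (ans σ (pos N (b n) univ univ)).1 :=
    fun n hn hnN => (hb n hn).trans (if_pos (by rwa [b.len_apply]))
  obtain ⟨s, hs⟩ : ∃ s, s = (ans σ (pos N (b N) univ univ)).2.1 := ⟨_, rfl⟩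
  have hhigh : ∀ n, N + 1 ≤ n → n % 2 = ((0 : Fin 2) : ℕ) → b (n + 1) =
      follow 0 σ (target₀ N D s) (fun _ => s) s (s ∩ (X.Win 0 (target₀ N D s))ᶜ) (b n) := by
    intro n hn hp
    rw [hb n hp]
    change ite _ _ _ = _
    rw [if_neg (by rw [b.len_apply]; omega), if_pos rfl, b.trunc_apply, min_eq_left (by omega),
      ← hs, follow₀]
  have hq : IsQuasi N s (b (N + 1)) := by
    have h := (ans_legal σ (legal_of_len_le (D := D) (b.len_apply N).le univ univ)).quasi
    rw [← hlow N hN le_rfl, b.len_apply, b.trunc_apply, min_self, ← hs] at h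
    exact h le_rfl
  have hN' : ∀ c, ans σ (pos N (b N) s c) = pos N (b (N + 1)) s c := fun c => by
    rw [pos_of_len_le (b.len_apply N).le s c univ univ, ans_eq_pos_left σ (b.len_apply N) c,
      ← hlow N hN le_rfl, ← hs]
  have hlow' : ∀ c n, n % 2 = 0 → n < N → b (n + 1) = (ans σ (pos N (b n) s c)).1 :=
    fun c n hn hnN => by
      rw [pos_of_len_le (by rw [b.len_apply]; omega) s c univ univ, hlow n hn hnN.le]
  rcases follow_cases (fun u hu => hu.2.2) hhigh with ⟨m, ⟨hms, hmD, hml⟩, hm⟩ | ⟨hW, hc⟩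
  · have hleg : ∀ n, Legal N D (pos N (b n) s (cone (b m))) := fun n => by
      refine b.legal (fun _ => hq) (fun _ => Or.inl ⟨b m, hms, hmD, hml, ?_, rfl⟩)
        fun i _ _ => b.mem_cone _ _
      rw [b.len_apply] at hml
      rw [b.trunc_apply, min_eq_left hml]
    refine exists_lift 0 σ b s (cone (b m)) hleg (fun n hn h => ?_) fun n hn h => ?_
    · rcases h with h | h
      · exact hlow' _ n hn h
      · rcases Nat.lt_or_ge n m with h' | h'
        · exact (ans_fst_of_lt σ (hleg n) h h').symm
        · exact hm n h' hn
    · have hn' : n % 2 = 0 := hn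
      obtain rfl : n = N := by omega
      exact hN' _
  · have hrep : b (N + 2) ∈ s → IsReply N D s (s ∩ (X.Win 0 (target₀ N D s))ᶜ) (b (N + 2)) := by
      refine fun h => Or.inr ⟨⟨h, hW _ (by omega)⟩, inter_subset_left, fun z ⟨hzs, hzW⟩ hzl =>
        ⟨fun hzD => hzW (subset_win _ _ ⟨hzs, hzD, hzl⟩), fun _ w hw hws =>
          ⟨hws, not_mem_win_of_isChild hzW ?_ hw⟩, fun hz1 => ?_⟩⟩
      · assumption
      · obtain ⟨w, hw, hwW⟩ := exists_isChild_not_mem_win hzW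
        exact ⟨w, hw, (hq.2 z hzs (by omega)).1 hz1 w hw, hwW⟩
    have hleg : ∀ n, (∀ i, N + 1 ≤ i → i ≤ n → b i ∈ s) →
        Legal N D (pos N (b n) s (s ∩ (X.Win 0 (target₀ N D s))ᶜ)) := fun n hn =>
      b.legal (fun _ => hq) (fun h => hrep (hn _ (by omega) h))
        fun i hi hin => ⟨hn i (by omega) hin, hW i (by omega)⟩
    have hbs : ∀ n, N + 1 ≤ n → b n ∈ s := fun n => by
      induction n using Nat.strong_induction_on with
      | _ n ih =>
        intro hn
        rcases Nat.eq_or_lt_of_le hn with rfl | hn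
        · exact hq.1
        · obtain ⟨n, rfl⟩ : ∃ l, n = l + 1 := ⟨n - 1, by omega⟩
          have ihn := ih n (by omega) (by omega)
          rcases Nat.mod_two_eq_zero_or_one n with h0 | h1
          · rw [hc n (by omega) h0]
            exact (ans_mem σ (hleg n fun i hi hin => ih i (by omega) hi)
              (by rw [b.len_apply]; omega)).1
          · exact (hq.2 _ ihn (by rw [b.len_apply]; omega)).1 (by rwa [b.len_apply]) _
              (b.isChild n)
    refine exists_lift 0 σ b s _ (fun n => hleg n fun i hi _ => hbs i hi)
      (fun n hn h => ?_) fun n hn h => ?_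
    · rcases h with h | h
      · exact hlow' _ n hn h
      · exact hc n (by omega) hn
    · have hn' : n % 2 = 0 := hn
      obtain rfl : n = N := by omega
      exact hN' _

/-- If the play reaches a position `u` that `σ` announces in answer to some quasi-strategy `s`, it
lifts to the play in which player `0` announced `s`. Otherwise player `1` could never force this,
and the play lifts to the one in which player `0` announced the quasi-strategy of preventing
player `1` from forcing it. -/
lemma unravelStrat_lift₁ (σ : (unravel N D hN).Strat) (b : X.Branch)
    (hb : (unravelStrat 1 σ).Consistent 1 b) :
    ∃ b' : (unravel N D hN).Branch, σ.Consistent 1 b' ∧ b'.map (unravelProj N D hN) = b := by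
  have hlow : ∀ s c n, n % 2 = 1 → n < N → b (n + 1) = (ans σ (pos N (b n) s c)).1 :=
    fun s c n hn hnN => by
      rw [pos_of_len_le (by rw [b.len_apply]; omega) s c univ univ]
      exact (hb n hn).trans (if_pos (by rw [b.len_apply]; omega))
  obtain ⟨g, hg⟩ : ∃ g, g = fun s => ans σ (pos N (b (N + 1)) s univ) := ⟨_, rfl⟩
  have hgc : ∀ s c, ans σ (pos N (b (N + 1)) s c) = g s := fun s c => by
    rw [hg, pos_of_len_le_succ (b.len_apply _).le s c univ]
  obtain ⟨U, hU⟩ : ∃ U, U = target₁ N D g (b (N + 1)) := ⟨_, rfl⟩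
  have hhigh : ∀ n, N + 1 ≤ n → n % 2 = ((1 : Fin 2) : ℕ) → b (n + 1) =
      follow 1 σ U (witness N D g (b (N + 1))) (X.Win 1 U)ᶜ (g (X.Win 1 U)ᶜ).2.2 (b n) := by
    intro n hn hp
    rw [hb n hp]
    change ite _ _ _ = _
    rw [if_neg (by rw [b.len_apply]; omega), if_neg (by decide), b.trunc_apply,
      min_eq_left (by omega), ← hg, follow₁, hU]
  have hUl : ∀ u ∈ U, N + 2 ≤ X.len u := by
    rw [hU]
    rintro u ⟨s, hs⟩
    exact hs.2.2.1
  rcases follow_cases hUl hhigh with ⟨m, hmU, hm⟩ | ⟨hW, hc⟩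
  · have hml := hUl _ hmU
    rw [b.len_apply] at hml
    obtain ⟨s, hs⟩ : ∃ s, s = witness N D g (b (N + 1)) (b m) := ⟨_, rfl⟩
    have hw : IsWitness N D g (b (N + 1)) (b m) s := by
      have hmU' : ∃ s, IsWitness N D g (b (N + 1)) (b m) s := by rwa [hU] at hmU
      rw [hs, witness, dif_pos hmU']
      exact hmU'.choose_spec
    rw [← hs] at hm
    obtain ⟨hms, hmD, -, hq, hgs⟩ := hw
    rw [b.trunc_apply, min_eq_left hml] at hgs
    have hleg : ∀ n, Legal N D (pos N (b n) s (cone (b m))) := fun n => by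
      refine b.legal (fun _ => hq) (fun _ => Or.inl ⟨b m, hms, hmD, by rwa [b.len_apply], ?_, rfl⟩)
        fun i _ _ => b.mem_cone _ _
      rw [b.trunc_apply, min_eq_left hml]
    refine exists_lift 1 σ b s (cone (b m)) hleg (fun n hn h => ?_) fun n hn h => ?_
    · rcases h with h | h
      · exact hlow _ _ n hn h
      · rcases Nat.lt_or_ge n m with h' | h'
        · exact (ans_fst_of_lt σ (hleg n) h h').symm
        · exact hm n h' hn
    · have hn' : n % 2 = 1 := hn
      obtain rfl : n = N + 1 := by omega
      rw [hgc, hgs, pos, if_neg (by rw [b.len_apply]; omega), if_neg (by rw [b.len_apply]; omega)]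
  · obtain ⟨s, hs⟩ : ∃ s, s = (X.Win 1 U)ᶜ := ⟨_, rfl⟩
    rw [← hs] at hc
    have hWs : ∀ n, N + 1 ≤ n → b n ∈ s := fun n hn => by rw [hs]; exact hW n hn
    have hq : IsQuasi N s (b (N + 1)) := by
      refine ⟨hWs _ le_rfl, fun z hz _ => ⟨fun h w hw => ?_, fun h => ?_⟩⟩
      · rw [hs] at hz ⊢
        exact not_mem_win_of_isChild hz h hw
      · rw [hs] at hz ⊢
        exact exists_isChild_not_mem_win hz
    have hleg1 : Legal N D (pos N (b (N + 1)) s univ) := b.legal (fun _ => hq)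
      (fun h => by omega) fun i _ _ => mem_univ _
    have hgl : Legal N D (g s) := by rw [hg]; exact ans_legal σ hleg1
    have hg1 : (g s).1 = b (N + 2) := by
      rw [hc (N + 1) le_rfl (by change (N + 1) % 2 = 1; omega), hgc]
    have hg2 : (g s).2.1 = s := by rw [hg]; exact ans_left σ hleg1 (by rw [b.len_apply])
    obtain ⟨c, hcdef⟩ : ∃ c, c = (g s).2.2 := ⟨_, rfl⟩
    rw [← hcdef] at hc
    have hgs : g s = (b (N + 2), s, c) := by
      rw [hcdef, ← hg1]
      exact Prod.ext rfl (Prod.ext hg2 rfl)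
    have hr : IsReply N D s c (b (N + 2)) := by
      have := hgl.reply (by rw [hg1, b.len_apply])
      rwa [hgs, b.trunc_apply, min_self] at this
    -- The answer to `s` cannot announce a position `u`, since `s` avoids all such `u`.
    obtain ⟨hbc, hcs, hcq⟩ := hr.resolve_left fun ⟨u, hus, huD, hul, hub, hcu⟩ => by
      have hu : u ∈ U := by
        rw [hU]
        exact ⟨s, hus, huD, hul, hq, by rw [hub, ← hcu, hgs]⟩
      rw [hs] at hus
      exact hus (subset_win _ _ hu)
    have hleg : ∀ n, (∀ i, N + 2 ≤ i → i ≤ n → b i ∈ c) → Legal N D (pos N (b n) s c) :=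
      fun n hn => b.legal (fun _ => hq) (fun _ => hr) hn
    have hbs : ∀ n, N + 2 ≤ n → b n ∈ c := fun n => by
      induction n using Nat.strong_induction_on with
      | _ n ih =>
        intro hn
        rcases Nat.eq_or_lt_of_le hn with rfl | hn
        · exact hbc
        · obtain ⟨n, rfl⟩ : ∃ l, n = l + 1 := ⟨n - 1, by omega⟩
          have ihn := ih n (by omega) (by omega)
          rcases Nat.mod_two_eq_zero_or_one n with h0 | h1
          · exact (hcq _ ihn (by rw [b.len_apply]; omega)).2.1 (by rwa [b.len_apply]) _
              (b.isChild n) (hWs _ (by omega))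
          · rw [hc n (by omega) h1]
            exact ans_mem σ (hleg n fun i hi hin => ih i (by omega) hi)
              (by rw [b.len_apply]; omega)
    refine exists_lift 1 σ b s c (fun n => hleg n fun i hi _ => hbs i hi)
      (fun n hn h => ?_) fun n hn h => ?_
    · rcases h with h | h
      · exact hlow _ _ n hn h
      · exact hc n (by omega) hn
    · have hn' : n % 2 = 1 := hn
      obtain rfl : n = N + 1 := by omega
      rw [hgc, hgs, pos, if_neg (by rw [b.len_apply]; omega), if_neg (by rw [b.len_apply]; omega)]

variable (N D hN) in
/-- The unraveling tree covers `X`. -/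
noncomputable def unravelCover : Cover N (unravel N D hN) X where
  toHom := unravelProj N D hN
  strat := unravelStrat
  strat_local := unravelStrat_local
  inj y z hy h := by
    change y.1.1 = z.1.1 at h
    refine Subtype.ext ?_
    rw [y.2.eq_pos, z.2.eq_pos, ← h]
    exact pos_of_len_le (x := y.1.1) hy _ _ _ _
  surj x hx := ⟨⟨pos N x univ univ, legal_of_len_le hx _ _⟩, rfl⟩
  strat_apply p σ y hy hp := by
    have hy' : X.len y.1.1 < N := hy
    have he : y.1 = pos N y.1.1 univ univ := by
      conv_lhs => rw [y.2.eq_pos]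
      exact pos_of_len_le hy'.le _ _ _ _
    change ite _ _ _ = (σ y).1.1
    have hl : X.len ((unravelProj N D hN).toFun y) ≤ N := hy'.le
    rw [if_pos hl]
    change (ans σ (pos N y.1.1 univ univ)).1 = _
    rw [← he, ans, dif_pos y.2]
    rfl
  lift p σ b hb := by
    fin_cases p
    · exact unravelStrat_lift₀ σ b hb
    · exact unravelStrat_lift₁ σ b hb

lemma unravel_branch_apply (b : (unravel N D hN).Branch) {n : ℕ} (hn : N + 2 ≤ n) :
    (b n).1.2 = (b (N + 2)).1.2 := by
  induction n, hn using Nat.le_induction with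
  | base => rfl
  | succ n hn ih =>
    rw [← ih]
    have h := congrArg (fun t => t.1.2) (b.par_apply n)
    have hl : X.len (X.par (b (n + 1)).1.1) = n := by
      rw [X.len_par]
      have : X.len (b (n + 1)).1.1 = n + 1 := b.len_apply (n + 1)
      omega
    change (ite _ _ _, ite _ _ _) = _ at h
    rw [if_neg (by omega), if_neg (by omega)] at h
    exact h

lemma unravel_branch_mem (b : (unravel N D hN).Branch) {n : ℕ} (hn : N + 2 ≤ n) :
    (b n).1.1 ∈ (b (N + 2)).1.2.2 := by
  have hl : X.len (b n).1.1 = n := b.len_apply n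
  have := (b n).2.mem n hn hl.ge
  rwa [trunc_of_len_le hl.le, unravel_branch_apply b hn] at this

/-- Whether a branch of the unraveling tree passes through `D` is decided by its position of
length `N + 2`. -/
lemma exists_mem_iff_reply_eq_cone (hD : ∀ b : X.Branch, ∀ m, b m ∈ D → ∃ n, ∀ l, n ≤ l → b l ∈ D)
    (b : (unravel N D hN).Branch) :
    (∃ n, (b n).1.1 ∈ D) ↔
      ∃ u ∈ D, N + 2 ≤ X.len u ∧ (b (N + 2)).1.2.2 = cone u := by
  have hl : X.len (b (N + 2)).1.1 = N + 2 := b.len_apply _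
  constructor
  · rintro ⟨m, hm⟩
    rcases (b (N + 2)).2.reply hl.ge with ⟨u, -, huD, hul, -, hc⟩ | ⟨-, -, hc⟩
    · exact ⟨u, huD, hul, hc⟩
    · obtain ⟨n, hn⟩ := hD (b.map (unravelProj N D hN)) m hm
      have hmem := unravel_branch_mem b (show N + 2 ≤ n + (N + 2) by omega)
      have hl' : X.len (b (n + (N + 2))).1.1 = n + (N + 2) := b.len_apply _
      exact absurd (hn (n + (N + 2)) (by omega)) (hc _ hmem (by omega)).1
  · rintro ⟨u, huD, hul, hc⟩
    have hmem := unravel_branch_mem b hul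
    have hl' : X.len (b (X.len u)).1.1 = X.len u := b.len_apply _
    rw [hc] at hmem
    have := eq_trunc_of_mem_cone hmem hl'.le
    rw [hl', trunc_of_len_le le_rfl] at this
    exact ⟨X.len u, by rwa [this]⟩

end Unravel

/-- Every open set of branches becomes clopen in a suitable covering. -/
theorem exists_cover_of_isOpenSet {O : Set X.Branch} (hO : IsOpenSet O) (k : ℕ) :
    ∃ (Y : PosTree.{u}) (c : Cover k Y X), IsOpenSet (Branch.map c.toHom ⁻¹' O) ∧
      IsOpenSet (Branch.map c.toHom ⁻¹' O)ᶜ := by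
  -- The length `2 * k` is even, and a `2 * k`-covering is in particular a `k`-covering.
  have hN : (2 * k) % 2 = 0 := by omega
  have hD : ∀ b : X.Branch, ∀ m, b m ∈ sure O → ∃ n, ∀ l, n ≤ l → b l ∈ sure O :=
    fun b m hm => hO.exists_mem_sure (mem_of_mem_sure hm)
  have key : ∀ b : (unravel (2 * k) (sure O) hN).Branch,
      b.map (unravelProj (2 * k) (sure O) hN) ∈ O ↔
        ∃ u ∈ sure O, 2 * k + 2 ≤ X.len u ∧ (b (2 * k + 2)).1.2.2 = cone u := fun b => by
    rw [← exists_mem_iff_reply_eq_cone hD b]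
    constructor
    · intro h
      obtain ⟨n, hn⟩ := hO.exists_mem_sure h
      exact ⟨n, hn n le_rfl⟩
    · rintro ⟨n, hn⟩
      exact mem_of_mem_sure (b := b.map (unravelProj (2 * k) (sure O) hN)) hn
  refine ⟨_, (unravelCover (2 * k) (sure O) hN).mono (by omega), hO.preimage _,
    fun b hb => ⟨2 * k + 2, fun b' h hb' => hb ?_⟩⟩
  refine (key b).2 ?_
  have := (key b').1 hb'
  rwa [h] at this

/-! ### Unraveling Borel sets -/

variable {X Y : PosTree.{u}}

/-- A set of branches is clopen if it and its complement are open. -/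
def IsClopenSet (C : Set X.Branch) : Prop := IsOpenSet C ∧ IsOpenSet Cᶜ

/-- A set of branches of `X` is unravelable if its preimage under any map `Y → X` becomes clopen
in a suitable `k`-covering of `Y`, for every `k`. Allowing maps to `X` makes the property pass to
coverings of `X`. -/
def Unravelable (C : Set X.Branch) : Prop :=
  ∀ (Y : PosTree.{u}) (f : Hom Y X) (k : ℕ), ∃ (Z : PosTree.{u}) (c : Cover k Z Y),
    IsClopenSet (Branch.map (f.comp c.toHom) ⁻¹' C)

lemma IsOpenSet.unravelable {O : Set X.Branch} (hO : IsOpenSet O) : Unravelable O :=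
  fun _ f k => exists_cover_of_isOpenSet (hO.preimage f) k

lemma Unravelable.compl {C : Set X.Branch} (hC : Unravelable C) : Unravelable Cᶜ :=
  fun Y f k => by
    obtain ⟨Z, c, h1, h2⟩ := hC Y f k
    refine ⟨Z, c, h2, ?_⟩
    rwa [← preimage_compl, compl_compl]

/-- The sets of a sequence are unraveled one after the other. In the inverse limit of these
coverings, the union is open, and can be unraveled by one more covering. -/
lemma Unravelable.iUnion {C : ℕ → Set X.Branch} (hC : ∀ i, Unravelable (C i)) :
    Unravelable (⋃ i, C i) := by
  intro Y f k
  have step : ∀ (i : ℕ) (S : Σ Z : PosTree.{u}, Hom Z X), ∃ (S' : Σ Z : PosTree.{u}, Hom Z X)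
      (c : Cover (k + i) S'.1 S.1), S'.2 = S.2.comp c.toHom ∧
        IsClopenSet (Branch.map S'.2 ⁻¹' C i) := fun i S => by
    obtain ⟨Z, c, h⟩ := hC i S.1 S.2 (k + i)
    exact ⟨⟨Z, S.2.comp c.toHom⟩, c, rfl, h⟩
  choose next cov hcov hclopen using step
  let S : ℕ → Σ Z : PosTree.{u}, Hom Z X := fun i => Nat.rec ⟨Y, f⟩ next i
  let W : ℕ → PosTree.{u} := fun i => (S i).1
  let c : ∀ i, Cover (k + i) (W (i + 1)) (W i) := fun i => cov i (S i)
  have hproj : ∀ i (b : (limit W c).Branch),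
      (b.map (limitProj W c i)).map (S i).2 = (b.map (limitProj W c 0)).map f := fun i b => by
    induction i with
    | zero => rfl
    | succ i ih =>
      rw [← ih, ← limitProj_map c i b]
      have h := hcov i (S i)
      change (S (i + 1)).2 = _ at h
      rw [h]
      rfl
  have hopen : IsOpenSet (Branch.map (f.comp (limitProj W c 0)) ⁻¹' ⋃ i, C i) := by
    intro b hb
    obtain ⟨i, hi⟩ := mem_iUnion.1 hb
    have h := (hclopen i (S i)).1.preimage (limitProj W c (i + 1))
    have hmem : ∀ b' : (limit W c).Branch,
        (b'.map (limitProj W c (i + 1))).map (S (i + 1)).2 ∈ C i ↔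
          (b'.map (limitProj W c 0)).map f ∈ C i := fun b' => iff_of_eq <|
      congrArg (· ∈ C i) (hproj (i + 1) b')
    obtain ⟨n, hn⟩ := h b ((hmem b).2 hi)
    exact ⟨n, fun b' hb' => mem_iUnion.2 ⟨i, (hmem b').1 (hn b' hb')⟩⟩
  obtain ⟨Z, d, hd⟩ := exists_cover_of_isOpenSet hopen k
  exact ⟨Z, (limitCover c).comp d, hd⟩

/-- Games with an unravelable payoff set are determined. -/
theorem Unravelable.exists_winning {C : Set X.Branch} (hC : Unravelable C) {r : X.Pos}
    (hr0 : X.len r = 0) (hr : ∀ x, X.len x = 0 → x = r) :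
    ∃ (p : Fin 2) (σ : X.Strat), ∀ b, σ.Consistent p b → (if p = 0 then b ∈ C else b ∉ C) := by
  obtain ⟨Z, c, hc, -⟩ := hC X (Hom.id X) 0
  obtain ⟨s, hs⟩ := c.surj r hr0.le
  have hs0 : Z.len s = 0 := by rw [← c.len_apply, hs, hr0]
  obtain ⟨p, σ, hσ⟩ := exists_winning_of_isOpenSet hc hs0 fun x hx => c.inj x s hx.le <| by
    rw [hs]
    exact hr _ (by rw [c.len_apply, hx])
  refine ⟨p, c.strat p σ, fun b hb => ?_⟩
  obtain ⟨b', hb', rfl⟩ := c.lift p σ b hb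
  exact hσ b' hb'

end PosTree

/-! ### Games on trees of lists -/

open PosTree

variable {A : Type u}

lemma initSeg_succ (b : ℕ → A) (n : ℕ) : initSeg b (n + 1) = initSeg b n ++ [b n] := by
  rw [initSeg, List.ofFn_succ_last]
  rfl

lemma length_initSeg (b : ℕ → A) (n : ℕ) : (initSeg b n).length = n := by
  simp [initSeg]

lemma dropLast_mem {T : Descriptive.tree A} {x : List A} (h : x ∈ T) : x.dropLast ∈ T :=
  Descriptive.Tree.mem_of_prefix x.dropLast_prefix h

namespace Game

/-- The tree of a Gale–Stewart game, as an abstract tree of positions. -/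
def posTree (G : Game A) : PosTree.{u} where
  Pos := {x : List A // x ∈ G.tree}
  len x := x.1.length
  par x := ⟨x.1.dropLast, dropLast_mem x.2⟩
  len_par x := x.1.length_dropLast
  exists_child x := by
    obtain ⟨a, ha⟩ := G.pruned x.1 x.2
    exact ⟨⟨x.1 ++ [a], ha⟩, Subtype.ext (by simp), by simp⟩

variable {G : Game A}

lemma exists_eq_append {x y : G.posTree.Pos} (h : G.posTree.IsChild y x) :
    ∃ a, y.1 = x.1 ++ [a] := by
  have hl : y.1.length = x.1.length + 1 := h.2
  have hne : y.1 ≠ [] := List.ne_nil_of_length_pos (by omega)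
  refine ⟨y.1.getLast hne, ?_⟩
  rw [← h.1]
  exact (List.dropLast_append_getLast hne).symm

/-- The play of the game given by a branch of the tree of positions. -/
noncomputable def toBody (b : G.posTree.Branch) : body G.tree := by
  refine ⟨fun n => (exists_eq_append (b.isChild n)).choose, fun n => ?_⟩
  have h : initSeg (fun n => (exists_eq_append (b.isChild n)).choose) n = (b n).1 := by
    induction n with
    | zero => exact (List.length_eq_zero_iff.1 (b.len_apply 0)).symm
    | succ n ih => rw [initSeg_succ, ih, ← (exists_eq_append (b.isChild n)).choose_spec]
  rw [h]
  exact (b n).2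

lemma append_toBody (b : G.posTree.Branch) (n : ℕ) : (b n).1 ++ [(toBody b).1 n] = (b (n + 1)).1 :=
  (exists_eq_append (b.isChild n)).choose_spec.symm

/-- The branch of the tree of positions given by a play of the game. -/
def ofBody (a : body G.tree) : G.posTree.Branch where
  toFun n := ⟨initSeg a.1 n, a.2 n⟩
  len_apply n := length_initSeg a.1 n
  par_apply n := Subtype.ext <| by
    change (initSeg a.1 (n + 1)).dropLast = _
    rw [initSeg_succ, List.dropLast_concat]

lemma toBody_ofBody (a : body G.tree) : toBody (ofBody a) = a := by
  refine Subtype.ext (funext fun n => ?_)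
  have h : initSeg a.1 n ++ [(toBody (ofBody a)).1 n] = initSeg a.1 (n + 1) :=
    append_toBody (ofBody a) n
  rw [initSeg_succ] at h
  simpa using h

/-- Open sets of the body are open in the sense of initial segments: a basic open set of the
product restricts finitely many coordinates only. -/
lemma isOpenSet_preimage_toBody {O : Set (body G.tree)}
    (hO : IsOpen[bodyTopology G.tree] O) : IsOpenSet (toBody (G := G) ⁻¹' O) := by
  intro b hb
  let _ : TopologicalSpace A := ⊥
  obtain ⟨V, hV, rfl⟩ := isOpen_induced_iff.1 hO
  obtain ⟨I, v, hv, hIV⟩ := isOpen_pi_iff.1 hV _ hb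
  refine ⟨I.sup id + 1, fun b' hb' => hIV fun i hi => ?_⟩
  have hle : i + 1 ≤ I.sup id + 1 := Nat.succ_le_succ (Finset.le_sup (f := id) hi)
  have h1 := append_toBody b i
  rw [← Branch.eq_of_le hle hb', ← append_toBody b' i,
    Branch.eq_of_le (i.le_succ.trans hle) hb'] at h1
  have h2 : (toBody b).1 i = (toBody b').1 i := by simpa using h1
  rw [← h2]
  exact (hv i hi).2

lemma IsBorel.unravelable (hG : G.IsBorel) : Unravelable (toBody (G := G) ⁻¹' G.payoff) := by
  refine MeasurableSpace.generateFrom_induction {s | IsOpen[bodyTopology G.tree] s}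
    (fun s _ => Unravelable (toBody (G := G) ⁻¹' s)) ?_ ?_ ?_ ?_ G.payoff hG
  · exact fun t ht _ => (isOpenSet_preimage_toBody ht).unravelable
  · exact IsOpenSet.unravelable fun b hb => hb.elim
  · exact fun t _ h => h.compl
  · intro s _ h
    rw [preimage_iUnion]
    exact Unravelable.iUnion h

/-- A strategy on the tree of positions, as a strategy of a player in the game. -/
noncomputable def strategyOf (σ : G.posTree.Strat) (i : Fin 2) : G.Strategy i := fun x hx _ =>
  ⟨(exists_eq_append (σ.isChild ⟨x, hx⟩)).choose, by
    rw [← (exists_eq_append (σ.isChild ⟨x, hx⟩)).choose_spec]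
    exact (σ ⟨x, hx⟩).2⟩

lemma append_strategyOf (σ : G.posTree.Strat) (i : Fin 2) (x : List A) (hx : x ∈ G.tree)
    (h : x.length % 2 = (i : ℕ)) : x ++ [(strategyOf σ i x hx h).1] = (σ ⟨x, hx⟩).1 :=
  (exists_eq_append (σ.isChild ⟨x, hx⟩)).choose_spec.symm

lemma consistent_ofBody {σ : G.posTree.Strat} {i : Fin 2} {a : body G.tree}
    (h : (strategyOf σ i).Consistent a) : σ.Consistent i (ofBody a) := fun n hn =>
  Subtype.ext <| by
    change initSeg a.1 (n + 1) = _
    rw [initSeg_succ, h n hn, append_strategyOf]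
    rfl

end Game

end GaleStewart

theorem mainTheorem1 {A : Type*} (G : GaleStewart.Game A) (hG : G.IsBorel) :
    G.IsDetermined := by
  have hnil : [] ∈ G.tree := by
    obtain ⟨x, hx⟩ := G.nonempty
    exact Descriptive.Tree.mem_of_prefix x.nil_prefix hx
  obtain ⟨p, σ, hσ⟩ := hG.unravelable.exists_winning (r := ⟨[], hnil⟩) rfl
    fun x hx => Subtype.ext (List.length_eq_zero_iff.1 hx)
  refine ⟨p, GaleStewart.Game.strategyOf σ p, fun a ha => ?_⟩
  have h := hσ _ (GaleStewart.Game.consistent_ofBody ha)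
  rwa [Set.mem_preimage, GaleStewart.Game.toBody_ofBody] at h
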